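/- A weight is a nonnegative measurable function $w$ on $(0,\infty)$, not almost everywhere $0$, with $W(t):=\int_0^t w(s)\,ds<\infty$ for all $t>0$. Write $w\in R_1$ if there is a constant $C$ with $\frac{W(s)}{s}\le C\,\frac{W(r)}{r}$ for all $0<r<s<\infty$. For a (real-valued) measurable function $f$ on $\mathbb R^n$, $n\ge 1$, let $f^*(t)=\inf\{y\ge 0: |\{x:|f(x)|>y\}|\le t\}$ be its decreasing rearrangement and $f^{**}(t)=\frac1t\int_0^t f^*(s)\,ds$. Identifying functions that agree almost everywhere, let $\Lambda^1(w)$ be the set of all $f$ with $\|f\|_{\Lambda^1(w)}=\int_0^\infty f^*(t)w(t)\,dt<\infty$ and, for $0<\alpha<1$, let $\Gamma^1_\alpha(w)$ be the set of all $f$ with $$\|f\|_{\Gamma^1_\alpha(w)}=\int_0^\infty (f^*(t))^{\alpha}(f^{**}(t))^{1-\alpha}w(t)\,dt<\infty$$ (with $0\cdot\infty=0$). We say that $\Gamma^1_\alpha(w)$ is a Banach space if it is a linear space and there is a norm on it, equivalent to $\|\cdot\|_{\Gamma^1_\alpha(w)}$, for which it is complete. Theorem. Let $w$ be a weight and $0<\alpha<1$.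 Then $\Gamma^1_\alpha(w)$ is a Banach space if and only if $w\in R_1$ and $\Gamma^1_\alpha(w)=\Lambda^1(w)$ (as sets). -/

import Mathlib

open MeasureTheory Set Filter Topology
open scoped ENNReal

noncomputable section

/-- Real-valued Lebesgue measurable functions on `ℝⁿ`, modulo equality almost everywhere. -/
abbrev LebesgueFun (n : ℕ) : Type :=
  EuclideanSpace ℝ (Fin n) →ₘ[(volume : Measure (EuclideanSpace ℝ (Fin n)))] ℝ

/-- A weight: a nonnegative measurable function on `(0, ∞)`, locally integrable on `[0, ∞)`.
The values of `w` outside `(0, ∞)` play no role. -/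
structure IsWeight (w : ℝ → ℝ) : Prop where
  nonneg : ∀ t : ℝ, 0 < t → 0 ≤ w t
  aemeasurable : AEMeasurable w (volume.restrict (Ioi (0 : ℝ)))
  locallyIntegrable : LocallyIntegrableOn w (Ici (0 : ℝ)) volume

/-- The primitive `W(t) = ∫₀ᵗ w(s) ds`. -/
def weightPrimitive (w : ℝ → ℝ) (t : ℝ) : ℝ := ∫ s in (0 : ℝ)..t, w s

/-- The class `R_p`: `W(s) / s ^ p ≤ C * W(r) / r ^ p` for all `0 < r < s < ∞`. -/
def IsRClass (p : ℝ) (w : ℝ → ℝ) : Prop :=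
  ∃ C : ℝ, 0 < C ∧ ∀ r s : ℝ, 0 < r → r < s →
    weightPrimitive w s / s ^ p ≤ C * (weightPrimitive w r / r ^ p)

/-- The decreasing rearrangement
`f^*(t) = inf {y ≥ 0 : |{x : |f(x)| > y}| ≤ t}`, with values in `[0, ∞]`. -/
def decRearrangement {n : ℕ} (f : EuclideanSpace ℝ (Fin n) → ℝ) (t : ℝ) : ℝ≥0∞ :=
  sInf {y : ℝ≥0∞ | volume {x | y < ‖f x‖ₑ} ≤ ENNReal.ofReal t}

/-- The maximal function `f^{**}(t) = (1 / t) ∫₀ᵗ f^*(s) ds`, used for `t > 0`. -/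
def maxRearrangement {n : ℕ} (f : EuclideanSpace ℝ (Fin n) → ℝ) (t : ℝ) : ℝ≥0∞ :=
  (∫⁻ s in Ioc (0 : ℝ) t, decRearrangement f s) / ENNReal.ofReal t

/-- `‖f‖_{Λ^p(w)} = (∫₀^∞ f^*(t)^p w(t) dt)^{1/p}`, with values in `[0, ∞]`. -/
def lambdaNorm {n : ℕ} (p : ℝ) (w : ℝ → ℝ) (f : LebesgueFun n) : ℝ≥0∞ :=
  (∫⁻ t in Ioi (0 : ℝ), decRearrangement f t ^ p * ENNReal.ofReal (w t)) ^ (1 / p)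

/-- `‖f‖_{Γ^p_α(w)} = (∫₀^∞ f^*(t)^α f^{**}(t)^{p - α} w(t) dt)^{1/p}`,
with values in `[0, ∞]`. -/
def gammaNorm {n : ℕ} (p α : ℝ) (w : ℝ → ℝ) (f : LebesgueFun n) : ℝ≥0∞ :=
  (∫⁻ t in Ioi (0 : ℝ), decRearrangement f t ^ α * maxRearrangement f t ^ (p - α) *
    ENNReal.ofReal (w t)) ^ (1 / p)

/-- The weighted Lorentz space `Λ^p(w)` on `ℝⁿ`. -/
def lambdaSpace (n : ℕ) (p : ℝ) (w : ℝ → ℝ) : Set (LebesgueFun n) :=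
  {f | lambdaNorm p w f < ∞}

/-- The space `Γ^p_α(w)` on `ℝⁿ`. -/
def gammaSpace (n : ℕ) (p α : ℝ) (w : ℝ → ℝ) : Set (LebesgueFun n) :=
  {f | gammaNorm p α w f < ∞}

/-- The set `{f | ρ f < ∞}` is a Banach space: it is a linear space and carries a complete norm
that is equivalent to the functional `ρ`. -/
def IsBanachSpaceFor {n : ℕ} (ρ : LebesgueFun n → ℝ≥0∞) : Prop :=
  ∃ V : Submodule ℝ (LebesgueFun n), (V : Set (LebesgueFun n)) = {f | ρ f < ∞} ∧
    ∃ N : Seminorm ℝ V,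
      (∀ f : V, N f = 0 → f = 0) ∧
      (∃ C : ℝ, 0 < C ∧ ∀ f : V,
        ENNReal.ofReal (N f) ≤ ENNReal.ofReal C * ρ f ∧
        ρ f ≤ ENNReal.ofReal C * ENNReal.ofReal (N f)) ∧
      (∀ u : ℕ → V,
        (∀ ε : ℝ, 0 < ε → ∃ K : ℕ, ∀ i j : ℕ, K ≤ i → K ≤ j → N (u i - u j) < ε) →
        ∃ g : V, Tendsto (fun k => N (u k - g)) atTop (𝓝 0))

end

/-! On a multiple `c` of the indicator of a set of measure `r`, both functionals equal `c * W(r)`: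
`f^*` and `f^{**}` agree where `f^*` is nonzero.

Necessity combines this with one consequence of normability: `ρ (∑ f i) ≤ K * ∑ ρ (f i)`, with `K`
independent of the number of terms. Covering a set of measure `s` by about `s / r` disjoint sets of
measure `r` gives `R_1`. Cutting `F` into dyadic layers `2 * 2 ^ j` on `{F > 2 ^ j}`, whose sum lies
between `F` and `4 F`, gives `Γ(F) ≤ 4 K Λ(F)`, hence `Λ ⊆ Γ`. The opposite inclusion is just `f^* ≤
f^{**}`.

For sufficiency, `R_1` makes `W` comparable to its least concave majorant, the primitive of a
decreasing weight `v`. By Hardy's lemma `Λ(w)` and `Λ(v)` have equivalent functionals; since `v`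
decreases and `F ↦ ∫₀ᵗ F^*` is subadditive, `Λ(v)` is a norm, complete by the Riesz–Fischer
argument. Equality of the sets `Γ` and `Λ(w)` upgrades to equivalence of functionals by condensation
of singularities: otherwise a suitable series would lie in `Λ(w)` but not in `Γ`. So the norm of
`Λ(v)` serves for `Γ`. -/

noncomputable section

/-! ### Decreasing rearrangements on a general measure space. -/

section Rearrangement

variable {X : Type*} [MeasurableSpace X] {μ : Measure X}

/-- The decreasing rearrangement of a function with values in `[0, ∞]`. -/
def rearr (μ : Measure X) (F : X → ℝ≥0∞) (t : ℝ) : ℝ≥0∞ :=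
  sInf {y : ℝ≥0∞ | μ {x | y < F x} ≤ ENNReal.ofReal t}

/-- The infimum defining the rearrangement is attained, because the distribution function is
right-continuous (continuity of the measure along levels decreasing to `y`). Algebraic identities
for rearrangements then reduce to identities of level sets. -/
theorem lt_rearr_iff (F : X → ℝ≥0∞) (t : ℝ) (y : ℝ≥0∞) :
    y < rearr μ F t ↔ ENNReal.ofReal t < μ {x | y < F x} := by
  constructor
  · intro h
    by_contra hc
    exact absurd h (not_lt.2 (sInf_le (not_lt.1 hc)))
  · intro h
    by_contra hc
    rw [not_lt] at hc
    refine absurd h (not_lt.2 ?_)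
    rcases eq_or_ne y ⊤ with rfl | hy
    · simp
    obtain ⟨u, hu, huy, hlim⟩ := exists_seq_strictAnti_tendsto' (lt_top_iff_ne_top.2 hy)
    have hset : {x | y < F x} = ⋃ k, {x | u k < F x} := by
      ext x
      simp only [mem_ofPred_eq, mem_iUnion]
      constructor
      · intro hx
        exact (hlim.eventually (gt_mem_nhds hx)).exists
      · rintro ⟨k, hk⟩
        exact (huy k).1.trans hk
    have hmono : Monotone fun k => {x | u k < F x} := by
      intro i j hij x hx
      exact lt_of_le_of_lt (hu.antitone hij) hx
    rw [hset, hmono.measure_iUnion]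
    refine iSup_le fun k => ?_
    have hk : rearr μ F t < u k := lt_of_le_of_lt hc (huy k).1
    obtain ⟨z, hz, hzk⟩ := sInf_lt_iff.1 hk
    exact (measure_mono fun x hx => hzk.trans hx).trans hz

theorem rearr_le_iff (F : X → ℝ≥0∞) (t : ℝ) (y : ℝ≥0∞) :
    rearr μ F t ≤ y ↔ μ {x | y < F x} ≤ ENNReal.ofReal t := by
  rw [← not_lt, lt_rearr_iff, not_lt]

theorem rearr_antitone (F : X → ℝ≥0∞) : Antitone (rearr μ F) := by
  intro s t hst
  rw [rearr_le_iff]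
  exact ((rearr_le_iff F s _).1 le_rfl).trans (ENNReal.ofReal_le_ofReal hst)

theorem measurable_rearr (F : X → ℝ≥0∞) : Measurable (rearr μ F) :=
  (rearr_antitone F).measurable

theorem rearr_mono {F G : X → ℝ≥0∞} (h : ∀ᵐ x ∂μ, F x ≤ G x) (t : ℝ) :
    rearr μ F t ≤ rearr μ G t := by
  rw [rearr_le_iff]
  refine le_trans (measure_mono_ae ?_) ((rearr_le_iff G t _).1 le_rfl)
  filter_upwards [h] with x hx hx'
  exact lt_of_lt_of_le hx' hx

theorem rearr_congr {F G : X → ℝ≥0∞} (h : F =ᵐ[μ] G) : rearr μ F = rearr μ G := by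
  funext t
  exact le_antisymm (rearr_mono h.le t) (rearr_mono h.symm.le t)

theorem rearr_iSup {F : ℕ → X → ℝ≥0∞} (hF : Monotone F) (t : ℝ) :
    rearr μ (fun x => ⨆ k, F k x) t = ⨆ k, rearr μ (F k) t := by
  refine eq_of_forall_lt_iff fun y => ?_
  have hset : {x | y < ⨆ k, F k x} = ⋃ k, {x | y < F k x} := by
    ext x
    simp [lt_iSup_iff]
  have hmono : Monotone fun k => {x | y < F k x} := by
    intro i j hij x hx
    exact lt_of_lt_of_le hx (hF hij x)
  rw [lt_rearr_iff, hset, hmono.measure_iUnion, lt_iSup_iff, lt_iSup_iff]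
  simp only [lt_rearr_iff]

theorem rearr_const_mul {c : ℝ≥0∞} (hc : c ≠ ⊤) (F : X → ℝ≥0∞) (t : ℝ) :
    rearr μ (fun x => c * F x) t = c * rearr μ F t := by
  rcases eq_or_ne c 0 with rfl | h0
  · refine le_antisymm ?_ (by simp)
    rw [rearr_le_iff]
    simp
  · refine eq_of_forall_lt_iff fun y => ?_
    have key : ∀ a : ℝ≥0∞, y < c * a ↔ y / c < a := fun a => by
      rw [ENNReal.div_lt_iff (Or.inl h0) (Or.inl hc), mul_comm]
    rw [lt_rearr_iff, key, lt_rearr_iff]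
    simp only [key]

theorem rearr_tsub (F : X → ℝ≥0∞) (y : ℝ≥0∞) (t : ℝ) :
    rearr μ (fun x => F x - y) t = rearr μ F t - y := by
  refine eq_of_forall_lt_iff fun z => ?_
  rw [lt_rearr_iff, lt_tsub_iff_right, lt_rearr_iff]
  simp only [lt_tsub_iff_right]

theorem rearr_indicator (A : Set X) (c : ℝ≥0∞) (t : ℝ) :
    rearr μ (A.indicator fun _ => c) t = {s : ℝ | ENNReal.ofReal s < μ A}.indicator (fun _ => c) t := by
  refine eq_of_forall_lt_iff fun y => ?_
  rw [lt_rearr_iff]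
  by_cases hy : y < c
  · have : {x | y < A.indicator (fun _ => c) x} = A := by
      ext x
      by_cases hx : x ∈ A <;> simp [hx, hy]
    rw [this]
    by_cases ht : ENNReal.ofReal t < μ A <;> simp [ht, hy]
  · have : {x | y < A.indicator (fun _ => c) x} = ∅ := by
      ext x
      by_cases hx : x ∈ A <;> simp [hx, not_lt.1 hy]
    rw [this]
    by_cases ht : ENNReal.ofReal t < μ A <;> simp [ht, not_lt.1 hy]

/-- The layer cake formula for functions with values in `[0, ∞]`. -/
theorem lintegral_eq_lintegral_measure_lt [SFinite μ] {H : X → ℝ≥0∞} (hH : Measurable H) :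
    ∫⁻ x, H x ∂μ = ∫⁻ y in Ioi (0 : ℝ), μ {x | ENNReal.ofReal y < H x} := by
  -- Each value is the length of `{y > 0 : y < a}`; Tonelli then exchanges the two integrals.
  have hslice : ∀ a : ℝ≥0∞,
      a = ∫⁻ y in Ioi (0 : ℝ), {y : ℝ | ENNReal.ofReal y < a}.indicator 1 y := by
    intro a
    rw [lintegral_indicator_one (measurableSet_lt ENNReal.measurable_ofReal measurable_const),
      Measure.restrict_apply (measurableSet_lt ENNReal.measurable_ofReal measurable_const)]
    rcases eq_or_ne a ⊤ with rfl | ha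
    · have : {y : ℝ | ENNReal.ofReal y < ⊤} ∩ Ioi 0 = Ioi 0 := by ext; simp
      rw [this, Real.volume_Ioi]
    · have : {y : ℝ | ENNReal.ofReal y < a} ∩ Ioi 0 = Ioo 0 a.toReal := by
        ext y
        simp only [mem_inter_iff, mem_ofPred_eq, mem_Ioi, mem_Ioo]
        constructor
        · rintro ⟨h1, h2⟩
          exact ⟨h2, (ENNReal.ofReal_lt_iff_lt_toReal h2.le ha).1 h1⟩
        · rintro ⟨h1, h2⟩
          exact ⟨(ENNReal.ofReal_lt_iff_lt_toReal h1.le ha).2 h2, h1⟩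
      rw [this, Real.volume_Ioo, sub_zero, ENNReal.ofReal_toReal ha]
  have hmeas : MeasurableSet {p : X × ℝ | ENNReal.ofReal p.2 < H p.1} :=
    measurableSet_lt (ENNReal.measurable_ofReal.comp measurable_snd) (hH.comp measurable_fst)
  calc ∫⁻ x, H x ∂μ
      = ∫⁻ x, (∫⁻ y in Ioi (0 : ℝ),
          {p : X × ℝ | ENNReal.ofReal p.2 < H p.1}.indicator 1 (x, y)) ∂μ :=
        lintegral_congr fun x => hslice (H x)
    _ = ∫⁻ y in Ioi (0 : ℝ), ∫⁻ x,
          {p : X × ℝ | ENNReal.ofReal p.2 < H p.1}.indicator 1 (x, y) ∂μ :=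
        lintegral_lintegral_swap (measurable_one.indicator hmeas).aemeasurable
    _ = _ := by
        refine lintegral_congr fun y => ?_
        have := lintegral_indicator_one (μ := μ)
          (measurableSet_lt (measurable_const (a := ENNReal.ofReal y)) hH)
        rw [← this]
        rfl

theorem volume_restrict_ofReal_lt (m : ℝ≥0∞) :
    (volume.restrict (Ioi (0 : ℝ))) {t : ℝ | ENNReal.ofReal t < m} = m := by
  rw [Measure.restrict_apply (measurableSet_lt ENNReal.measurable_ofReal measurable_const)]
  rcases eq_or_ne m ⊤ with rfl | ha
  · have : {y : ℝ | ENNReal.ofReal y < ⊤} ∩ Ioi 0 = Ioi 0 := by ext; simp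
    rw [this, Real.volume_Ioi]
  · have : {y : ℝ | ENNReal.ofReal y < m} ∩ Ioi 0 = Ioo 0 m.toReal := by
      ext y
      simp only [mem_inter_iff, mem_ofPred_eq, mem_Ioi, mem_Ioo]
      constructor
      · rintro ⟨h1, h2⟩
        exact ⟨h2, (ENNReal.ofReal_lt_iff_lt_toReal h2.le ha).1 h1⟩
      · rintro ⟨h1, h2⟩
        exact ⟨(ENNReal.ofReal_lt_iff_lt_toReal h1.le ha).2 h2, h1⟩
    rw [this, Real.volume_Ioo, sub_zero, ENNReal.ofReal_toReal ha]

/-- Equimeasurability: level sets on both sides have the same measure, so the layer cake formulas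
coincide. -/
theorem lintegral_rearr [SFinite μ] {H : X → ℝ≥0∞} (hH : Measurable H) :
    ∫⁻ t in Ioi (0 : ℝ), rearr μ H t = ∫⁻ x, H x ∂μ := by
  rw [lintegral_eq_lintegral_measure_lt (measurable_rearr H), lintegral_eq_lintegral_measure_lt hH]
  simp only [lt_rearr_iff, volume_restrict_ofReal_lt]

/-- Together with `le_lintegral_Ioc_rearr` this is the variational formula `∫₀ᵗ F^* = min_y (y t + ∫
(F - y)₊)` for `t ≥ 0`, the minimum being attained at `y = F^*(t)`. -/
theorem lintegral_Ioc_rearr_le [SFinite μ] {F : X → ℝ≥0∞} (hF : Measurable F) (t : ℝ)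
    (y : ℝ≥0∞) :
    ∫⁻ s in Ioc (0 : ℝ) t, rearr μ F s ≤ y * ENNReal.ofReal t + ∫⁻ x, (F x - y) ∂μ := by
  calc ∫⁻ s in Ioc (0 : ℝ) t, rearr μ F s
      ≤ ∫⁻ s in Ioc (0 : ℝ) t, (y + (rearr μ F s - y)) :=
        lintegral_mono fun s => le_add_tsub
    _ = y * ENNReal.ofReal t + ∫⁻ s in Ioc (0 : ℝ) t, (rearr μ F s - y) := by
        rw [lintegral_add_left measurable_const]
        simp
    _ ≤ y * ENNReal.ofReal t + ∫⁻ s in Ioi (0 : ℝ), (rearr μ F s - y) := by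
        gcongr
        exact Ioc_subset_Ioi_self
    _ = _ := by
        rw [← lintegral_rearr (hF.sub_const y)]
        simp only [rearr_tsub]

theorem le_lintegral_Ioc_rearr [SFinite μ] {F : X → ℝ≥0∞} (hF : Measurable F) {t : ℝ}
    (ht : 0 ≤ t) :
    rearr μ F t * ENNReal.ofReal t + ∫⁻ x, (F x - rearr μ F t) ∂μ ≤
      ∫⁻ s in Ioc (0 : ℝ) t, rearr μ F s := by
  set y := rearr μ F t with hy
  rw [← lintegral_rearr (hF.sub_const y)]
  simp only [rearr_tsub]
  have hsplit : ∫⁻ s in Ioi (0 : ℝ), (rearr μ F s - y) =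
      ∫⁻ s in Ioc (0 : ℝ) t, (rearr μ F s - y) := by
    rw [← Ioc_union_Ioi_eq_Ioi ht, lintegral_union measurableSet_Ioi
      (Set.disjoint_left.2 fun x hx hx' => absurd hx.2 (not_le.2 hx'))]
    have : ∫⁻ s in Ioi t, (rearr μ F s - y) = 0 := by
      rw [setLIntegral_congr_fun (g := fun _ => 0) measurableSet_Ioi
        fun s hs => tsub_eq_zero_of_le (rearr_antitone F (le_of_lt hs))]
      simp
    rw [this, add_zero]
  have hcongr : ∫⁻ s in Ioc (0 : ℝ) t, rearr μ F s =
      ∫⁻ s in Ioc (0 : ℝ) t, (y + (rearr μ F s - y)) :=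
    setLIntegral_congr_fun measurableSet_Ioc
      fun s hs => (add_tsub_cancel_of_le (rearr_antitone F hs.2)).symm
  rw [hsplit, hcongr, lintegral_add_left measurable_const]
  simp

/-- Subadditivity of `F ↦ ∫₀ᵗ F^*`. -/
theorem lintegral_Ioc_rearr_subadd [SFinite μ] {F G H : X → ℝ≥0∞} (hF : Measurable F)
    (hG : Measurable G) (hH : Measurable H) (h : ∀ᵐ x ∂μ, F x ≤ G x + H x) (t : ℝ) :
    ∫⁻ s in Ioc (0 : ℝ) t, rearr μ F s ≤
      (∫⁻ s in Ioc (0 : ℝ) t, rearr μ G s) + ∫⁻ s in Ioc (0 : ℝ) t, rearr μ H s := by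
  rcases lt_or_ge t 0 with ht | ht
  · simp [Ioc_eq_empty (not_lt.2 ht.le)]
  -- The levels `y` and `z` are optimal for `G` and `H`; the level `y + z` is a competitor for `F`.
  set y := rearr μ G t
  set z := rearr μ H t
  have h1 : ∫⁻ x, (F x - (y + z)) ∂μ ≤ ∫⁻ x, (G x - y) ∂μ + ∫⁻ x, (H x - z) ∂μ := by
    rw [← lintegral_add_left (hG.sub_const y)]
    refine lintegral_mono_ae ?_
    filter_upwards [h] with x hx
    exact (tsub_le_tsub_right hx _).trans add_tsub_add_le_tsub_add_tsub
  calc _ ≤ (y + z) * ENNReal.ofReal t + ∫⁻ x, (F x - (y + z)) ∂μ :=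
        lintegral_Ioc_rearr_le hF t _
    _ ≤ (y + z) * ENNReal.ofReal t + (∫⁻ x, (G x - y) ∂μ + ∫⁻ x, (H x - z) ∂μ) := by gcongr
    _ = (y * ENNReal.ofReal t + ∫⁻ x, (G x - y) ∂μ) +
        (z * ENNReal.ofReal t + ∫⁻ x, (H x - z) ∂μ) := by ring
    _ ≤ _ := add_le_add (le_lintegral_Ioc_rearr hG ht) (le_lintegral_Ioc_rearr hH ht)

end Rearrangement

/-! ### Hardy's lemma for decreasing functions. -/

section Hardy

/-- A lower set with a greatest element is a closed half-line; any other is a directed union of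
closed half-lines with rational endpoints. -/
theorem IsLowerSet.measure_le_of_forall_Iic {ν₁ ν₂ : Measure ℝ}
    (h : ∀ t, ν₁ (Iic t) ≤ ν₂ (Iic t)) {S : Set ℝ} (hS : IsLowerSet S) : ν₁ S ≤ ν₂ S := by
  by_cases hmax : ∃ a, IsGreatest S a
  · obtain ⟨a, ha⟩ := hmax
    have : S = Iic a := Subset.antisymm (fun x hx => ha.2 hx) (fun x hx => hS hx ha.1)
    rw [this]
    exact h a
  · have hU : S = ⋃ q : {q : ℚ // (q : ℝ) ∈ S}, Iic ((q : ℚ) : ℝ) := by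
      refine Subset.antisymm (fun x hx => ?_) (iUnion_subset fun q x hx => hS hx q.2)
      have : ∃ z ∈ S, x < z := by
        by_contra! hc
        exact hmax ⟨x, hx, fun z hz => hc z hz⟩
      obtain ⟨z, hz, hxz⟩ := this
      obtain ⟨q, hq1, hq2⟩ := exists_rat_btwn hxz
      exact mem_iUnion.2 ⟨⟨q, hS hq2.le hz⟩, hq1.le⟩
    have hdir : Directed (· ⊆ ·) fun q : {q : ℚ // (q : ℝ) ∈ S} => Iic ((q : ℚ) : ℝ) := by
      intro p q
      rcases le_total (p : ℚ) q with hpq | hpq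
      · exact ⟨q, Iic_subset_Iic.2 (by exact_mod_cast hpq), subset_rfl⟩
      · exact ⟨p, subset_rfl, Iic_subset_Iic.2 (by exact_mod_cast hpq)⟩
    rw [hU, hdir.measure_iUnion, hdir.measure_iUnion]
    exact iSup_mono fun q => h _

/-- Hardy's lemma: an inequality between distribution functions passes to integrals of decreasing
functions. -/
theorem Antitone.lintegral_le_of_forall_Iic {ν₁ ν₂ : Measure ℝ} [SFinite ν₁] [SFinite ν₂]
    (h : ∀ t, ν₁ (Iic t) ≤ ν₂ (Iic t)) {g : ℝ → ℝ≥0∞} (hg : Antitone g) :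
    ∫⁻ t, g t ∂ν₁ ≤ ∫⁻ t, g t ∂ν₂ := by
  rw [lintegral_eq_lintegral_measure_lt hg.measurable,
    lintegral_eq_lintegral_measure_lt hg.measurable]
  refine lintegral_mono fun y => IsLowerSet.measure_le_of_forall_Iic h ?_
  intro a b hab ha
  exact lt_of_lt_of_le ha (hg hab)

end Hardy

/-! ### The two functionals: monotonicity, homogeneity, monotone convergence, indicators. -/

section Functionals

variable {X : Type*} [MeasurableSpace X] {μ : Measure X}

/-- The maximal function `F^{**}` of a function with values in `[0, ∞]`. -/
def maxRearr (μ : Measure X) (F : X → ℝ≥0∞) (t : ℝ) : ℝ≥0∞ :=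
  (∫⁻ s in Ioc (0 : ℝ) t, rearr μ F s) / ENNReal.ofReal t

/-- The functional `∫ F^* dν`. -/
def lorentz (μ : Measure X) (ν : Measure ℝ) (F : X → ℝ≥0∞) : ℝ≥0∞ := ∫⁻ t, rearr μ F t ∂ν

/-- The functional `∫ (F^*)^α (F^{**})^{1-α} dν`. -/
def mixedLorentz (μ : Measure X) (ν : Measure ℝ) (α : ℝ) (F : X → ℝ≥0∞) : ℝ≥0∞ :=
  ∫⁻ t, rearr μ F t ^ α * maxRearr μ F t ^ (1 - α) ∂ν

variable {ν : Measure ℝ} {α : ℝ}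

theorem measurable_maxRearr (F : X → ℝ≥0∞) : Measurable (maxRearr μ F) := by
  refine Measurable.div ?_ ENNReal.measurable_ofReal
  refine Monotone.measurable fun s t hst => ?_
  exact lintegral_mono_set (Ioc_subset_Ioc_right hst)

theorem maxRearr_mono {F G : X → ℝ≥0∞} (h : ∀ᵐ x ∂μ, F x ≤ G x) (t : ℝ) :
    maxRearr μ F t ≤ maxRearr μ G t :=
  ENNReal.div_le_div_right (lintegral_mono fun s => rearr_mono h s) _

theorem rearr_le_maxRearr (F : X → ℝ≥0∞) {t : ℝ} (ht : 0 < t) :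
    rearr μ F t ≤ maxRearr μ F t := by
  rw [maxRearr, ENNReal.le_div_iff_mul_le (Or.inl (by simpa using ht)) (Or.inl (by simp))]
  calc rearr μ F t * ENNReal.ofReal t = ∫⁻ _ in Ioc (0 : ℝ) t, rearr μ F t := by simp
    _ ≤ _ := setLIntegral_mono (measurable_rearr F) fun s hs => rearr_antitone F hs.2

theorem maxRearr_const_mul {c : ℝ≥0∞} (hc : c ≠ ⊤) (F : X → ℝ≥0∞) (t : ℝ) :
    maxRearr μ (fun x => c * F x) t = c * maxRearr μ F t := by
  simp only [maxRearr, rearr_const_mul hc]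
  rw [lintegral_const_mul _ (measurable_rearr F), mul_div_assoc]

theorem maxRearr_iSup {F : ℕ → X → ℝ≥0∞} (hF : Monotone F) (t : ℝ) :
    maxRearr μ (fun x => ⨆ k, F k x) t = ⨆ k, maxRearr μ (F k) t := by
  simp only [maxRearr, rearr_iSup hF]
  rw [lintegral_iSup (fun k => measurable_rearr _)
    fun i j hij s => rearr_mono (ae_of_all _ fun x => hF hij x) s, ENNReal.iSup_div]

theorem maxRearr_indicator {A : Set X} {c : ℝ≥0∞} {t : ℝ} (ht : 0 < t)
    (htA : ENNReal.ofReal t < μ A) : maxRearr μ (A.indicator fun _ => c) t = c := by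
  have : ∫⁻ s in Ioc (0 : ℝ) t, rearr μ (A.indicator fun _ => c) s =
      ∫⁻ _ in Ioc (0 : ℝ) t, c := by
    refine setLIntegral_congr_fun measurableSet_Ioc fun s hs => ?_
    rw [rearr_indicator, indicator_of_mem]
    exact lt_of_le_of_lt (ENNReal.ofReal_le_ofReal hs.2) htA
  rw [maxRearr, this]
  simp only [lintegral_const, Measure.restrict_apply MeasurableSet.univ, univ_inter,
    Real.volume_Ioc, sub_zero]
  exact ENNReal.mul_div_cancel_right (by simpa using ht) (by simp)

theorem lorentz_mono {F G : X → ℝ≥0∞} (h : ∀ᵐ x ∂μ, F x ≤ G x) :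
    lorentz μ ν F ≤ lorentz μ ν G := lintegral_mono fun t => rearr_mono h t

theorem lorentz_congr {F G : X → ℝ≥0∞} (h : F =ᵐ[μ] G) : lorentz μ ν F = lorentz μ ν G := by
  rw [lorentz, lorentz, rearr_congr h]

theorem lorentz_const_mul {c : ℝ≥0∞} (hc : c ≠ ⊤) (F : X → ℝ≥0∞) :
    lorentz μ ν (fun x => c * F x) = c * lorentz μ ν F := by
  simp only [lorentz, rearr_const_mul hc]
  rw [lintegral_const_mul _ (measurable_rearr F)]

theorem lorentz_iSup {F : ℕ → X → ℝ≥0∞} (hF : Monotone F) :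
    lorentz μ ν (fun x => ⨆ k, F k x) = ⨆ k, lorentz μ ν (F k) := by
  simp only [lorentz, rearr_iSup hF]
  exact lintegral_iSup (fun k => measurable_rearr _)
    fun i j hij s => rearr_mono (ae_of_all _ fun x => hF hij x) s

theorem mixedLorentz_mono (hα : 0 ≤ α) (hα' : α ≤ 1) {F G : X → ℝ≥0∞}
    (h : ∀ᵐ x ∂μ, F x ≤ G x) : mixedLorentz μ ν α F ≤ mixedLorentz μ ν α G :=
  lintegral_mono fun t => mul_le_mul' (ENNReal.rpow_le_rpow (rearr_mono h t) hα)
    (ENNReal.rpow_le_rpow (maxRearr_mono h t) (sub_nonneg.2 hα'))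

theorem mixedLorentz_congr {F G : X → ℝ≥0∞} (h : F =ᵐ[μ] G) :
    mixedLorentz μ ν α F = mixedLorentz μ ν α G := by
  simp only [mixedLorentz, maxRearr, rearr_congr h]

theorem rpow_mul_rpow_one_sub (hα : 0 ≤ α) (hα' : α ≤ 1) (c : ℝ≥0∞) :
    c ^ α * c ^ (1 - α) = c := by
  rw [← ENNReal.rpow_add_of_nonneg _ _ hα (sub_nonneg.2 hα')]
  simp

theorem lorentz_le_mixedLorentz (hν : ∀ᵐ t ∂ν, 0 < t) (hα : 0 ≤ α) (hα' : α ≤ 1)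
    (F : X → ℝ≥0∞) : lorentz μ ν F ≤ mixedLorentz μ ν α F := by
  refine lintegral_mono_ae ?_
  filter_upwards [hν] with t ht
  calc rearr μ F t = rearr μ F t ^ α * rearr μ F t ^ (1 - α) :=
        (rpow_mul_rpow_one_sub hα hα' _).symm
    _ ≤ _ := by
      gcongr
      exact rearr_le_maxRearr F ht

theorem measurable_rearr_rpow_mul_maxRearr_rpow (α : ℝ) (F : X → ℝ≥0∞) :
    Measurable fun t => rearr μ F t ^ α * maxRearr μ F t ^ (1 - α) :=
  ((measurable_rearr F).pow_const _).mul ((measurable_maxRearr F).pow_const _)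

theorem mixedLorentz_const_mul (hα : 0 ≤ α) (hα' : α ≤ 1) {c : ℝ≥0∞} (hc : c ≠ ⊤)
    (F : X → ℝ≥0∞) :
    mixedLorentz μ ν α (fun x => c * F x) = c * mixedLorentz μ ν α F := by
  simp only [mixedLorentz, rearr_const_mul hc, maxRearr_const_mul hc]
  rw [← lintegral_const_mul _ (measurable_rearr_rpow_mul_maxRearr_rpow α F)]
  refine lintegral_congr fun t => ?_
  rw [ENNReal.mul_rpow_of_nonneg _ _ hα, ENNReal.mul_rpow_of_nonneg _ _ (sub_nonneg.2 hα')]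
  nth_rewrite 3 [← rpow_mul_rpow_one_sub hα hα' c]
  ring

theorem mixedLorentz_iSup (hα : 0 < α) (hα' : α < 1) {F : ℕ → X → ℝ≥0∞} (hF : Monotone F) :
    mixedLorentz μ ν α (fun x => ⨆ k, F k x) = ⨆ k, mixedLorentz μ ν α (F k) := by
  have h1 : ∀ t, Monotone fun k => rearr μ (F k) t ^ α := fun t i j hij =>
    ENNReal.rpow_le_rpow (rearr_mono (ae_of_all _ fun x => hF hij x) t) hα.le
  have h2 : ∀ t, Monotone fun k => maxRearr μ (F k) t ^ (1 - α) := fun t i j hij =>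
    ENNReal.rpow_le_rpow (maxRearr_mono (ae_of_all _ fun x => hF hij x) t) (sub_pos.2 hα').le
  have hpow : ∀ (u : ℕ → ℝ≥0∞) {p : ℝ}, 0 < p → (⨆ k, u k) ^ p = ⨆ k, u k ^ p :=
    fun u p hp => (ENNReal.orderIsoRpow p hp).map_iSup u
  simp only [mixedLorentz, rearr_iSup hF, maxRearr_iSup hF, hpow _ hα, hpow _ (sub_pos.2 hα')]
  rw [← lintegral_iSup (fun k => measurable_rearr_rpow_mul_maxRearr_rpow α (F k))
    fun i j hij t => mul_le_mul' (h1 t hij) (h2 t hij)]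
  refine lintegral_congr fun t => ?_
  rw [ENNReal.iSup_mul]
  -- Both factors increase in the index, so the double supremum is reached on the diagonal, through
  -- `max i j`.
  refine le_antisymm (iSup_le fun i => ?_) (iSup_le fun i => ?_)
  · rw [ENNReal.mul_iSup]
    exact iSup_le fun j => le_iSup_of_le (max i j)
      (mul_le_mul' (h1 t (le_max_left i j)) (h2 t (le_max_right i j)))
  · exact le_iSup_of_le i (mul_le_mul' le_rfl (le_iSup (fun k => maxRearr μ (F k) t ^ (1 - α)) i))

/-- For `0 < t < μ A` both rearrangements equal `c`. Beyond `μ A` the factor `0 ^ α = 0` kills the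
tail of `F^{**}`; this is where `α > 0` matters. -/
theorem mixedLorentz_indicator (hν : ∀ᵐ t ∂ν, 0 < t) (hα : 0 < α) (hα' : α ≤ 1) (A : Set X)
    (c : ℝ≥0∞) :
    mixedLorentz μ ν α (A.indicator fun _ => c) = c * ν {t | ENNReal.ofReal t < μ A} := by
  have hm : MeasurableSet {t : ℝ | ENNReal.ofReal t < μ A} :=
    measurableSet_lt ENNReal.measurable_ofReal measurable_const
  rw [← lintegral_indicator_const hm]
  refine lintegral_congr_ae ?_
  filter_upwards [hν] with t ht
  rw [rearr_indicator]
  by_cases h : ENNReal.ofReal t < μ A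
  · have h' : t ∈ {t : ℝ | ENNReal.ofReal t < μ A} := h
    rw [maxRearr_indicator ht h, indicator_of_mem h', rpow_mul_rpow_one_sub hα.le hα']
  · have h' : t ∉ {t : ℝ | ENNReal.ofReal t < μ A} := h
    rw [indicator_of_notMem h', ENNReal.zero_rpow_of_pos hα, zero_mul]

end Functionals

/-! ### The weight as a measure on the line, and its primitive. -/

section WeightMeasure

/-- The measure `w(t) dt` on `(0, ∞)`. -/
def weightMeasure (w : ℝ → ℝ) : Measure ℝ :=
  (volume.restrict (Ioi (0 : ℝ))).withDensity fun t => ENNReal.ofReal (w t)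

theorem weightMeasure_pos (w : ℝ → ℝ) : ∀ᵐ t ∂weightMeasure w, 0 < t :=
  (withDensity_absolutelyContinuous _ _).ae_le (ae_restrict_mem measurableSet_Ioi)

instance (w : ℝ → ℝ) : SFinite (weightMeasure w) := by
  unfold weightMeasure
  infer_instance

variable {n : ℕ} {w : ℝ → ℝ}

theorem lintegral_weightMeasure (hw : AEMeasurable w (volume.restrict (Ioi (0 : ℝ))))
    {g : ℝ → ℝ≥0∞} (hg : Measurable g) :
    ∫⁻ t, g t ∂weightMeasure w = ∫⁻ t in Ioi (0 : ℝ), g t * ENNReal.ofReal (w t) := by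
  rw [weightMeasure, lintegral_withDensity_eq_lintegral_mul₀ hw.ennreal_ofReal
    hg.aemeasurable]
  exact lintegral_congr fun t => mul_comm _ _

theorem lambdaNorm_one_eq (hw : IsWeight w) (f : LebesgueFun n) :
    lambdaNorm 1 w f = lorentz volume (weightMeasure w) fun x => ‖f x‖ₑ := by
  rw [lorentz, lintegral_weightMeasure hw.aemeasurable (measurable_rearr _)]
  simp only [lambdaNorm, div_one, ENNReal.rpow_one]
  rfl

theorem gammaNorm_one_eq (hw : IsWeight w) (α : ℝ) (f : LebesgueFun n) :
    gammaNorm 1 α w f = mixedLorentz volume (weightMeasure w) α fun x => ‖f x‖ₑ := by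
  rw [mixedLorentz, lintegral_weightMeasure hw.aemeasurable
    (measurable_rearr_rpow_mul_maxRearr_rpow α _)]
  simp only [gammaNorm, div_one, ENNReal.rpow_one]
  rfl

theorem IsWeight.intervalIntegrable (hw : IsWeight w) {a b : ℝ} (ha : 0 ≤ a) (hb : 0 ≤ b) :
    IntervalIntegrable w volume a b := by
  refine (hw.locallyIntegrable.integrableOn_compact_subset (t := uIcc a b) ?_
    isCompact_uIcc).intervalIntegrable
  intro x hx
  exact le_trans (le_min ha hb) hx.1

theorem IsWeight.weightPrimitive_nonneg (hw : IsWeight w) {t : ℝ} (ht : 0 ≤ t) :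
    0 ≤ weightPrimitive w t := by
  rw [weightPrimitive, intervalIntegral.integral_of_le ht]
  exact setIntegral_nonneg measurableSet_Ioc fun s hs => hw.nonneg s hs.1

theorem weightMeasure_Iic (hw : IsWeight w) {t : ℝ} (ht : 0 ≤ t) :
    weightMeasure w (Iic t) = ENNReal.ofReal (weightPrimitive w t) := by
  rw [weightMeasure, withDensity_apply _ measurableSet_Iic,
    Measure.restrict_restrict measurableSet_Iic, inter_comm, Ioi_inter_Iic, weightPrimitive,
    intervalIntegral.integral_of_le ht,
    ofReal_integral_eq_lintegral_ofReal
      ((intervalIntegrable_iff_integrableOn_Ioc_of_le ht).1 (hw.intervalIntegrable le_rfl ht))]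
  exact (ae_restrict_iff' measurableSet_Ioc).2 (ae_of_all _ fun s hs => hw.nonneg s hs.1)

theorem weightMeasure_Iic_of_nonpos {t : ℝ} (ht : t ≤ 0) : weightMeasure w (Iic t) = 0 := by
  have := weightMeasure_pos w
  rw [ae_iff] at this
  refine measure_mono_null (fun x hx => ?_) this
  exact not_lt.2 (le_trans hx ht)

theorem weightMeasure_Iio (w : ℝ → ℝ) (t : ℝ) :
    weightMeasure w (Iio t) = weightMeasure w (Iic t) := by
  refine measure_congr ?_
  refine (withDensity_absolutelyContinuous _ _).ae_le ?_
  exact ae_restrict_of_ae Iio_ae_eq_Iic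

theorem weightMeasure_ofReal_lt (hw : IsWeight w) {r : ℝ} (hr : 0 ≤ r) :
    weightMeasure w {t | ENNReal.ofReal t < ENNReal.ofReal r} =
      ENNReal.ofReal (weightPrimitive w r) := by
  rw [← weightMeasure_Iic hw hr, ← weightMeasure_Iio]
  rcases hr.eq_or_lt with rfl | hr
  · rw [weightMeasure_Iio, weightMeasure_Iic_of_nonpos le_rfl]
    simp
  · congr 1
    ext t
    simp [ENNReal.ofReal_lt_ofReal_iff hr]

theorem IsWeight.weightPrimitive_mono (hw : IsWeight w) {s t : ℝ} (hs : 0 ≤ s) (hst : s ≤ t) :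
    weightPrimitive w s ≤ weightPrimitive w t := by
  have h := measure_mono (μ := weightMeasure w) (Iic_subset_Iic.2 hst)
  rw [weightMeasure_Iic hw hs, weightMeasure_Iic hw (hs.trans hst)] at h
  exact (ENNReal.ofReal_le_ofReal_iff (hw.weightPrimitive_nonneg (hs.trans hst))).1 h

end WeightMeasure

/-! ### Necessity: uniform finite subadditivity and the `R_1` condition. -/

section Necessity

variable {n : ℕ} {w : ℝ → ℝ} {α : ℝ}

/-- The norm is subadditive with constant one, so the equivalence constant is paid only on entering
and on leaving it: `C * C` works for any number of terms. -/
theorem IsBanachSpaceFor.exists_sum_le {ρ : LebesgueFun n → ℝ≥0∞} (h : IsBanachSpaceFor ρ) :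
    ∃ K : ℝ, 0 < K ∧ ∀ (ι : Type) (s : Finset ι) (f : ι → LebesgueFun n), (∀ i ∈ s, ρ (f i) < ∞) →
      ρ (∑ i ∈ s, f i) ≤ ENNReal.ofReal K * ∑ i ∈ s, ρ (f i) := by
  obtain ⟨V, hV, N, -, ⟨C, hC, hCN⟩, -⟩ := h
  have hmem : ∀ f, f ∈ V ↔ ρ f < ∞ := fun f => by
    rw [← SetLike.mem_coe, hV]
    rfl
  refine ⟨C * C, by positivity, fun ι s f hf => ?_⟩
  classical
  let g : ι → V := fun i => if hi : ρ (f i) < ∞ then ⟨f i, (hmem _).2 hi⟩ else 0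
  have hg : ∀ i ∈ s, (g i : LebesgueFun n) = f i := fun i hi => by simp [g, hf i hi]
  have hsum : ((∑ i ∈ s, g i : V) : LebesgueFun n) = ∑ i ∈ s, f i := by
    rw [AddSubmonoidClass.coe_finsetSum]
    exact Finset.sum_congr rfl hg
  have hN : N (∑ i ∈ s, g i) ≤ ∑ i ∈ s, N (g i) :=
    Finset.le_sum_of_subadditive N (map_zero N).le (map_add_le_add N) s g
  calc ρ (∑ i ∈ s, f i) ≤ ENNReal.ofReal C * ENNReal.ofReal (N (∑ i ∈ s, g i)) := by
        rw [← hsum]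
        exact (hCN _).2
    _ ≤ ENNReal.ofReal C * ENNReal.ofReal (∑ i ∈ s, N (g i)) := by gcongr
    _ = ENNReal.ofReal C * ∑ i ∈ s, ENNReal.ofReal (N (g i)) := by
        rw [ENNReal.ofReal_sum_of_nonneg fun i _ => apply_nonneg N _]
    _ ≤ ENNReal.ofReal C * ∑ i ∈ s, ENNReal.ofReal C * ρ (f i) := by
        gcongr with i hi
        rw [← hg i hi]
        exact (hCN _).1
    _ = _ := by
        rw [← Finset.mul_sum, ← mul_assoc, ENNReal.ofReal_mul hC.le]

theorem gammaNorm_one_mk (hw : IsWeight w) {g : EuclideanSpace ℝ (Fin n) → ℝ}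
    (hg : AEStronglyMeasurable g volume) :
    gammaNorm 1 α w (AEEqFun.mk g hg) =
      mixedLorentz volume (weightMeasure w) α fun x => ‖g x‖ₑ := by
  rw [gammaNorm_one_eq hw]
  refine mixedLorentz_congr ?_
  filter_upwards [AEEqFun.coeFn_mk g hg] with x hx
  rw [hx]

/-- Normability of `Γ_α^1(w)` bounds the functional on finite sums of multiples of indicator
functions. -/
theorem IsBanachSpaceFor.mixedLorentz_sum_indicator_le (hw : IsWeight w) (hα : 0 < α)
    (hα' : α ≤ 1) (h : IsBanachSpaceFor (gammaNorm (n := n) 1 α w)) :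
    ∃ K : ℝ, 0 < K ∧ ∀ (ι : Type) (s : Finset ι) (c : ι → ℝ)
      (A : ι → Set (EuclideanSpace ℝ (Fin n))), (∀ i, 0 ≤ c i) → (∀ i, MeasurableSet (A i)) →
      mixedLorentz volume (weightMeasure w) α
        (fun x => ∑ i ∈ s, (A i).indicator (fun _ => ENNReal.ofReal (c i)) x) ≤
      ENNReal.ofReal K * ∑ i ∈ s, ENNReal.ofReal (c i) *
        weightMeasure w {t | ENNReal.ofReal t < volume (A i)} := by
  obtain ⟨K, hK, hKs⟩ := h.exists_sum_le
  refine ⟨K, hK, fun ι s c A hc hA => ?_⟩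
  let ψ : ι → EuclideanSpace ℝ (Fin n) → ℝ := fun i => (A i).indicator fun _ => c i
  have hψ : ∀ i, AEStronglyMeasurable (ψ i) volume := fun i =>
    (measurable_const.indicator (hA i)).aestronglyMeasurable
  have henorm : ∀ i x, ‖ψ i x‖ₑ = (A i).indicator (fun _ => ENNReal.ofReal (c i)) x := by
    intro i x
    by_cases hx : x ∈ A i <;> simp [ψ, hx, Real.enorm_eq_ofReal (hc i)]
  have hρ : ∀ i, gammaNorm 1 α w (AEEqFun.mk (ψ i) (hψ i)) =
      ENNReal.ofReal (c i) * weightMeasure w {t | ENNReal.ofReal t < volume (A i)} := by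
    intro i
    rw [gammaNorm_one_mk hw]
    simp only [henorm]
    exact mixedLorentz_indicator (weightMeasure_pos w) hα hα' (A i) _
  by_cases hfin : ∀ i ∈ s, gammaNorm 1 α w (AEEqFun.mk (ψ i) (hψ i)) < ∞
  · have key := hKs ι s (fun i => AEEqFun.mk (ψ i) (hψ i)) hfin
    simp only [hρ] at key
    refine le_trans (le_of_eq ?_) key
    rw [gammaNorm_one_eq hw]
    refine mixedLorentz_congr ?_
    have hsum : ∀ s : Finset ι, ((∑ i ∈ s, AEEqFun.mk (ψ i) (hψ i) : LebesgueFun n) :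
        EuclideanSpace ℝ (Fin n) → ℝ) =ᵐ[volume] fun x => ∑ i ∈ s, ψ i x := by
      intro s
      classical
      induction s using Finset.induction_on with
      | empty =>
        simp only [Finset.sum_empty]
        exact AEEqFun.coeFn_zero
      | insert a s ha ih =>
        rw [Finset.sum_insert ha]
        filter_upwards [ih, AEEqFun.coeFn_add (AEEqFun.mk (ψ a) (hψ a))
          (∑ i ∈ s, AEEqFun.mk (ψ i) (hψ i)), AEEqFun.coeFn_mk (ψ a) (hψ a)] with x h1 h2 h3
        rw [h2, Pi.add_apply, h1, h3, Finset.sum_insert ha]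
    have hψ0 : ∀ i x, 0 ≤ ψ i x := fun i x => indicator_nonneg (fun _ _ => hc i) x
    filter_upwards [hsum s] with x hx
    rw [hx, Real.enorm_eq_ofReal (Finset.sum_nonneg fun i _ => hψ0 i x),
      ENNReal.ofReal_sum_of_nonneg fun i _ => hψ0 i x]
    refine Finset.sum_congr rfl fun i _ => ?_
    rw [← henorm, Real.enorm_eq_ofReal (hψ0 i x)]
  -- If some summand has infinite functional, the right-hand side is infinite, since `c i * w{...}`
  -- is exactly that functional and `K > 0`.
  · push Not at hfin
    obtain ⟨i, hi, hi'⟩ := hfin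
    rw [hρ, top_le_iff] at hi'
    have : ∑ i ∈ s, ENNReal.ofReal (c i) *
        weightMeasure w {t | ENNReal.ofReal t < volume (A i)} = ⊤ :=
      ENNReal.sum_eq_top.2 ⟨i, hi, hi'⟩
    rw [this, ENNReal.mul_top (by simpa using hK)]
    exact le_top

/-- The box `[a, b) × [0, 1)^{n-1}`. -/
def slab (hn : 0 < n) (a b : ℝ) : Set (EuclideanSpace ℝ (Fin n)) :=
  {x | WithLp.ofLp x ∈ Set.pi univ fun i => Ico (if i = ⟨0, hn⟩ then a else 0)
    (if i = ⟨0, hn⟩ then b else 1)}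

theorem mem_slab {hn : 0 < n} {a b : ℝ} {x : EuclideanSpace ℝ (Fin n)} :
    x ∈ slab hn a b ↔ x ⟨0, hn⟩ ∈ Ico a b ∧ ∀ i, i ≠ ⟨0, hn⟩ → x i ∈ Ico (0 : ℝ) 1 := by
  simp only [slab, mem_ofPred_eq, Set.mem_pi, mem_univ, true_implies]
  constructor
  · intro h
    exact ⟨by simpa using h ⟨0, hn⟩, fun i hi => by simpa [hi] using h i⟩
  · rintro ⟨h1, h2⟩ i
    by_cases hi : i = ⟨0, hn⟩
    · subst hi
      simpa using h1
    · simpa [hi] using h2 i hi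

theorem measurableSet_slab (hn : 0 < n) (a b : ℝ) : MeasurableSet (slab hn a b) :=
  (PiLp.volume_preserving_ofLp (Fin n)).measurable
    (MeasurableSet.univ_pi fun _ => measurableSet_Ico)

theorem volume_slab (hn : 0 < n) (a b : ℝ) : volume (slab hn a b) = ENNReal.ofReal (b - a) := by
  have h := (PiLp.volume_preserving_ofLp (Fin n)).measure_preimage
    (MeasurableSet.univ_pi fun i => measurableSet_Ico (a := if i = ⟨0, hn⟩ then a else (0 : ℝ))
      (b := if i = ⟨0, hn⟩ then b else (1 : ℝ))).nullMeasurableSet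
  refine h.trans ?_
  rw [Real.volume_pi_Ico, Finset.prod_eq_single ⟨0, hn⟩]
  · simp
  · intro i _ hi
    simp [hi]
  · simp

theorem IsBanachSpaceFor.isRClass (hn : 0 < n) (hw : IsWeight w) (hα : 0 < α) (hα' : α ≤ 1)
    (h : IsBanachSpaceFor (gammaNorm (n := n) 1 α w)) : IsRClass 1 w := by
  obtain ⟨K, hK, hKs⟩ := h.mixedLorentz_sum_indicator_le hw hα hα'
  refine ⟨2 * K, by positivity, fun r s hr hrs => ?_⟩
  have hs : 0 < s := hr.trans hrs
  -- `m` slabs of width `r` cover the slab of width `s`, and `m r ≤ s + r ≤ 2 s`; this is the source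
  -- of the factor `2` in `2 * K`.
  set m : ℕ := ⌈s / r⌉₊ with hm
  have hm1 : s ≤ m * r := by
    have := Nat.le_ceil (s / r)
    rwa [div_le_iff₀ hr] at this
  have hm2 : (m : ℝ) * r ≤ 2 * s := by
    have := (Nat.ceil_lt_add_one (div_pos hs hr).le).le
    have h3 : (m : ℝ) * r ≤ (s / r + 1) * r := mul_le_mul_of_nonneg_right this hr.le
    rw [add_mul, div_mul_cancel₀ _ hr.ne'] at h3
    linarith
  have key := hKs ℕ (Finset.range m) (fun _ => 1) (fun i => slab hn (i * r) ((i + 1) * r))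
    (fun _ => zero_le_one) (fun i => measurableSet_slab _ _ _)
  have hvol : ∀ i : ℕ, volume (slab hn (i * r) ((i + 1) * r)) = ENNReal.ofReal r := fun i => by
    rw [volume_slab]
    congr 1
    ring
  simp only [hvol, weightMeasure_ofReal_lt hw hr.le, ENNReal.ofReal_one, one_mul,
    Finset.sum_const, Finset.card_range, nsmul_eq_mul] at key
  have hlow : ENNReal.ofReal (weightPrimitive w s) ≤ mixedLorentz volume (weightMeasure w) α
      (fun x => ∑ i ∈ Finset.range m,
        (slab hn (i * r) ((i + 1) * r)).indicator (fun _ => (1 : ℝ≥0∞)) x) := by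
    rw [← weightMeasure_ofReal_lt hw hs.le]
    have h1 := mixedLorentz_indicator (μ := (volume : Measure (EuclideanSpace ℝ (Fin n))))
      (weightMeasure_pos w) hα hα' (slab hn 0 s) 1
    rw [volume_slab, sub_zero, one_mul] at h1
    rw [← h1]
    refine mixedLorentz_mono hα.le hα' (ae_of_all _ fun x => ?_)
    by_cases hx : x ∈ slab hn 0 s
    · rw [indicator_of_mem hx]
      obtain ⟨⟨hx0, hxs⟩, hx'⟩ := mem_slab.1 hx
      -- The tile containing `x` is found by rounding down its first coordinate in units of `r`.
      set i := ⌊x ⟨0, hn⟩ / r⌋₊ with hi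
      have hi1 : (i : ℝ) * r ≤ x ⟨0, hn⟩ := by
        have := Nat.floor_le (div_nonneg hx0 hr.le)
        rwa [le_div_iff₀ hr] at this
      have hi2 : x ⟨0, hn⟩ < (i + 1) * r := by
        have := Nat.lt_floor_add_one (x ⟨0, hn⟩ / r)
        rwa [div_lt_iff₀ hr] at this
      have him : i < m := by
        have : (i : ℝ) * r < m * r := by linarith
        exact_mod_cast lt_of_mul_lt_mul_right this hr.le
      calc (1 : ℝ≥0∞) = (slab hn (i * r) ((i + 1) * r)).indicator (fun _ => (1 : ℝ≥0∞)) x := by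
            rw [indicator_of_mem]
            exact mem_slab.2 ⟨⟨hi1, hi2⟩, hx'⟩
        _ ≤ _ := Finset.single_le_sum
            (f := fun i : ℕ => (slab hn (i * r) ((i + 1) * r)).indicator (fun _ => (1 : ℝ≥0∞)) x)
            (fun _ _ => bot_le) (Finset.mem_range.2 him)
    · rw [indicator_of_notMem hx]
      exact bot_le
  have hWr := hw.weightPrimitive_nonneg hr.le
  have hfinal : weightPrimitive w s ≤ K * (m * weightPrimitive w r) := by
    have := hlow.trans key
    rw [← ENNReal.ofReal_natCast, ← ENNReal.ofReal_mul (by positivity),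
      ← ENNReal.ofReal_mul hK.le] at this
    exact (ENNReal.ofReal_le_ofReal_iff (by positivity)).1 this
  rw [Real.rpow_one, Real.rpow_one, div_le_iff₀ hs]
  calc weightPrimitive w s ≤ K * (m * weightPrimitive w r) := hfinal
    _ = K * (m * r) * (weightPrimitive w r / r) := by field_simp
    _ ≤ K * (2 * s) * (weightPrimitive w r / r) := by gcongr
    _ = _ := by ring

/-! ### Necessity: dyadic layers and the inclusion of `Λ` in `Γ`. -/

theorem sum_range_dyadic_le (a : ℝ≥0∞) (k : ℤ) (N : ℕ) :
    ∑ i ∈ Finset.range N, (if (2 : ℝ≥0∞) ^ (k + i) < a then 2 * (2 : ℝ≥0∞) ^ (k + i) else 0) ≤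
      min (2 * 2 ^ (k + N)) (4 * a) := by
  -- The unconditional geometric bound is carried along to close the induction: when a new term is
  -- active, it gives a total of at most `4 * 2 ^ (k + N)`, which activity bounds by `4 * a`.
  induction N with
  | zero => simp
  | succ N ih =>
    have hpow : (2 : ℝ≥0∞) * 2 ^ (k + (N + 1 : ℕ)) = 2 * 2 ^ (k + N) + 2 * 2 ^ (k + N) := by
      push_cast
      rw [← add_assoc, ENNReal.zpow_add (by simp) (by simp), zpow_one]
      ring
    rw [Finset.sum_range_succ]
    split_ifs with h
    · refine (add_le_add_left (ih.trans (min_le_left _ _)) _).trans (le_min hpow.ge ?_)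
      calc (2 : ℝ≥0∞) * 2 ^ (k + N) + 2 * 2 ^ (k + N) = 4 * 2 ^ (k + N) := by ring
        _ ≤ 4 * a := by gcongr
    · rw [add_zero]
      refine ih.trans (min_le_min_right _ ?_)
      rw [hpow]
      exact le_self_add

/-- A sum of multiples of indicator functions of dyadic level sets. -/
def dyadicSum {X : Type*} (F : X → ℝ≥0∞) (k : ℕ) (x : X) : ℝ≥0∞ :=
  ∑ i ∈ Finset.range (2 * k),
    if (2 : ℝ≥0∞) ^ (-(k : ℤ) + i) < F x then 2 * (2 : ℝ≥0∞) ^ (-(k : ℤ) + i) else 0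

theorem dyadicSum_eq {X : Type*} (F : X → ℝ≥0∞) (k : ℕ) (x : X) :
    dyadicSum F k x = ∑ i ∈ Finset.range (2 * k), {x | (2 : ℝ≥0∞) ^ (-(k : ℤ) + i) < F x}.indicator
      (fun _ => (2 : ℝ≥0∞) * 2 ^ (-(k : ℤ) + i)) x := by
  simp [dyadicSum, indicator_apply]

/-- The exponents run over `-k, …, k - 1`; passing to `k + 1` adds one term at each end. -/
theorem dyadicSum_monotone {X : Type*} (F : X → ℝ≥0∞) : Monotone (dyadicSum F) := by
  refine monotone_nat_of_le_succ fun k x => ?_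
  rw [dyadicSum, dyadicSum, show 2 * (k + 1) = (2 * k + 1) + 1 by ring, Finset.sum_range_succ,
    Finset.sum_range_succ']
  refine le_trans (le_of_eq ?_) (le_self_add.trans le_self_add)
  refine Finset.sum_congr rfl fun i _ => ?_
  rw [show (-((k + 1 : ℕ) : ℤ) + ((i + 1 : ℕ) : ℤ)) = -(k : ℤ) + i by push_cast; ring]

theorem le_iSup_dyadicSum {X : Type*} (F : X → ℝ≥0∞) (x : X) (hx : F x ≠ ⊤) :
    F x ≤ ⨆ k, dyadicSum F k x := by
  rcases eq_or_ne (F x) 0 with h0 | h0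
  · rw [h0]
    exact bot_le
  -- With `2 ^ m < F x ≤ 2 ^ (m + 1)`, the single layer of exponent `m` already dominates `F x`.
  obtain ⟨m, hm1, hm2⟩ := ENNReal.exists_mem_Ioc_zpow h0 hx (y := 2) (by norm_num) (by simp)
  refine le_iSup_of_le (m.natAbs + 1) ?_
  have him : (m + (m.natAbs + 1 : ℕ)).toNat ∈ Finset.range (2 * (m.natAbs + 1)) := by
    rw [Finset.mem_range]
    omega
  have hcast : -((m.natAbs + 1 : ℕ) : ℤ) + ((m + (m.natAbs + 1 : ℕ)).toNat : ℤ) = m := by omega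
  refine le_trans ?_ (Finset.single_le_sum (fun _ _ => bot_le) him)
  rw [hcast, if_pos hm1]
  refine hm2.trans (le_of_eq ?_)
  rw [ENNReal.zpow_add (by simp) (by simp), zpow_one, mul_comm]

theorem IsBanachSpaceFor.mixedLorentz_le (hw : IsWeight w) (hα : 0 < α) (hα' : α < 1)
    (h : IsBanachSpaceFor (gammaNorm (n := n) 1 α w)) :
    ∃ K : ℝ, 0 < K ∧ ∀ F : EuclideanSpace ℝ (Fin n) → ℝ≥0∞, Measurable F → (∀ x, F x ≠ ⊤) →
      mixedLorentz volume (weightMeasure w) α F ≤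
        ENNReal.ofReal K * lorentz volume (weightMeasure w) F := by
  obtain ⟨K, hK, hKs⟩ := h.mixedLorentz_sum_indicator_le hw hα hα'.le
  refine ⟨K * 4, by positivity, fun F hF hFtop => ?_⟩
  refine (mixedLorentz_mono hα.le hα'.le
    (ae_of_all _ fun x => le_iSup_dyadicSum F x (hFtop x))).trans ?_
  rw [mixedLorentz_iSup hα hα' (dyadicSum_monotone F)]
  refine iSup_le fun k => ?_
  have hc : ∀ j : ℤ, ENNReal.ofReal (2 * 2 ^ j) = 2 * 2 ^ j := fun j => by
    rw [ENNReal.ofReal_mul zero_le_two, ← Real.rpow_intCast, ← ENNReal.ofReal_rpow_of_pos two_pos,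
      ENNReal.rpow_intCast]
    simp
  have key := hKs ℕ (Finset.range (2 * k)) (fun i => 2 * 2 ^ (-(k : ℤ) + i))
    (fun i => {x | 2 ^ (-(k : ℤ) + i) < F x}) (fun i => by positivity)
    (fun i => measurableSet_lt measurable_const hF)
  -- The condition `t < |{F > 2 ^ j}|` means `F^*(t) > 2 ^ j`, so the sum of weights becomes the
  -- integral of the dyadic sum of `F^*`, which is at most `4 F^*`.
  simp only [hc, ← lt_rearr_iff] at key
  simp only [← dyadicSum_eq] at key
  refine key.trans ?_
  rw [ENNReal.ofReal_mul hK.le, mul_assoc]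
  gcongr
  have hmeas : ∀ j : ℤ, MeasurableSet {t | (2 : ℝ≥0∞) ^ j < rearr volume F t} := fun j =>
    measurableSet_lt measurable_const (measurable_rearr F)
  calc ∑ i ∈ Finset.range (2 * k), (2 : ℝ≥0∞) * 2 ^ (-(k : ℤ) + i) *
        weightMeasure w {t | (2 : ℝ≥0∞) ^ (-(k : ℤ) + i) < rearr volume F t}
      = ∑ i ∈ Finset.range (2 * k), ∫⁻ t, {t | (2 : ℝ≥0∞) ^ (-(k : ℤ) + i) < rearr volume F t}.indicator
          (fun _ => (2 : ℝ≥0∞) * 2 ^ (-(k : ℤ) + i)) t ∂weightMeasure w := by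
        refine Finset.sum_congr rfl fun i _ => ?_
        rw [lintegral_indicator_const (hmeas _)]
    _ = ∫⁻ t, dyadicSum (rearr volume F) k t ∂weightMeasure w := by
        rw [← lintegral_finsetSum _ fun i _ => measurable_const.indicator (hmeas _)]
        simp only [dyadicSum_eq]
    _ ≤ ∫⁻ t, ENNReal.ofReal 4 * rearr volume F t ∂weightMeasure w := by
        refine lintegral_mono fun t => ?_
        refine (sum_range_dyadic_le _ _ _).trans ((min_le_right _ _).trans (le_of_eq ?_))
        simp
    _ = _ := lintegral_const_mul _ (measurable_rearr F)

theorem gammaSpace_subset_lambdaSpace (hw : IsWeight w) (hα : 0 ≤ α) (hα' : α ≤ 1) :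
    gammaSpace n 1 α w ⊆ lambdaSpace n 1 w := by
  intro f hf
  simp only [gammaSpace, lambdaSpace, mem_ofPred_eq] at hf ⊢
  rw [gammaNorm_one_eq hw] at hf
  rw [lambdaNorm_one_eq hw]
  exact (lorentz_le_mixedLorentz (weightMeasure_pos w) hα hα' _).trans_lt hf

theorem LebesgueFun.measurable_enorm (f : LebesgueFun n) : Measurable fun x => ‖f x‖ₑ :=
  f.measurable.enorm

theorem IsBanachSpaceFor.gammaSpace_eq (hw : IsWeight w) (hα : 0 < α) (hα' : α < 1)
    (h : IsBanachSpaceFor (gammaNorm (n := n) 1 α w)) :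
    gammaSpace n 1 α w = lambdaSpace n 1 w := by
  refine (gammaSpace_subset_lambdaSpace hw hα.le hα'.le).antisymm fun f hf => ?_
  obtain ⟨K, -, hK⟩ := h.mixedLorentz_le hw hα hα'
  simp only [gammaSpace, lambdaSpace, mem_ofPred_eq] at hf ⊢
  rw [lambdaNorm_one_eq hw] at hf
  rw [gammaNorm_one_eq hw]
  exact (hK _ f.measurable_enorm fun x => enorm_ne_top).trans_lt
    (ENNReal.mul_lt_top ENNReal.ofReal_lt_top hf)

end Necessity

/-! ### From `R_1` to a decreasing weight with comparable primitive. -/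

section ConcaveMajorant

/-- The least concave majorant, on `[0, ∞)`, of a nonnegative function. -/
def concaveMajorant (W : ℝ → ℝ) (t : ℝ) : ℝ :=
  sInf {y | ∃ a b : ℝ, 0 ≤ a ∧ 0 ≤ b ∧ (∀ s, 0 ≤ s → W s ≤ a + b * s) ∧ y = a + b * t}

variable {W : ℝ → ℝ} {C : ℝ}

theorem concaveMajorant_le {t a b : ℝ} (ht : 0 ≤ t) (ha : 0 ≤ a) (hb : 0 ≤ b)
    (h : ∀ s, 0 ≤ s → W s ≤ a + b * s) : concaveMajorant W t ≤ a + b * t := by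
  refine csInf_le ⟨0, ?_⟩ ⟨a, b, ha, hb, h, rfl⟩
  rintro y ⟨a, b, ha, hb, -, rfl⟩
  positivity

/-- `W` is increasing and `W(t) / t` is decreasing up to a constant. -/
structure IsQuasiconcave (W : ℝ → ℝ) (C : ℝ) : Prop where
  nonneg : ∀ t, 0 ≤ t → 0 ≤ W t
  mono : ∀ s t, 0 ≤ s → s ≤ t → W s ≤ W t
  const_nonneg : 0 ≤ C
  div_le : ∀ r s, 0 < r → r < s → W s / s ≤ C * (W r / r)

namespace IsQuasiconcave

/-- The constant term handles `s ≤ t` by monotonicity, the linear term handles `s > t` by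
quasi-decrease of `W(s) / s`. At `s = t` the line has height `(1 + C) W(t)`, which gives the
comparison with the majorant. -/
theorem le_line (hW : IsQuasiconcave W C) {t : ℝ} (ht : 0 < t) (s : ℝ) (hs : 0 ≤ s) :
    W s ≤ W t + C * (W t / t) * s := by
  have h0 := hW.nonneg t ht.le
  have hC := hW.const_nonneg
  rcases le_or_gt s t with h | h
  · have := hW.mono s t hs h
    have : 0 ≤ C * (W t / t) * s := by positivity
    linarith
  · have h1 := hW.div_le t s ht h
    rw [div_le_iff₀ (ht.trans h)] at h1
    linarith

theorem le_concaveMajorant_of (hW : IsQuasiconcave W C) {t x : ℝ}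
    (h : ∀ a b : ℝ, 0 ≤ a → 0 ≤ b → (∀ s, 0 ≤ s → W s ≤ a + b * s) → x ≤ a + b * t) :
    x ≤ concaveMajorant W t := by
  have h1 := hW.nonneg 1 zero_le_one
  have hC := hW.const_nonneg
  refine le_csInf ⟨_, W 1, C * (W 1 / 1), h1, by positivity,
    hW.le_line one_pos, rfl⟩ ?_
  rintro y ⟨a, b, ha, hb, hab, rfl⟩
  exact h a b ha hb hab

theorem le_concaveMajorant (hW : IsQuasiconcave W C) {t : ℝ} (ht : 0 ≤ t) :
    W t ≤ concaveMajorant W t :=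
  hW.le_concaveMajorant_of fun _ _ _ _ h => h t ht

theorem concaveMajorant_nonneg (hW : IsQuasiconcave W C) {t : ℝ} (ht : 0 ≤ t) :
    0 ≤ concaveMajorant W t := (hW.nonneg t ht).trans (hW.le_concaveMajorant ht)

theorem concaveMajorant_le_mul (hW : IsQuasiconcave W C) {t : ℝ} (ht : 0 < t) :
    concaveMajorant W t ≤ (1 + C) * W t := by
  have h0 := hW.nonneg t ht.le
  have hC := hW.const_nonneg
  refine (concaveMajorant_le ht.le h0 (by positivity) (hW.le_line ht)).trans (le_of_eq ?_)
  field_simp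

theorem monotoneOn_concaveMajorant (hW : IsQuasiconcave W C) :
    MonotoneOn (concaveMajorant W) (Ici 0) := by
  intro s hs t ht hst
  refine hW.le_concaveMajorant_of fun a b ha hb h => (concaveMajorant_le hs ha hb h).trans ?_
  gcongr

theorem concaveOn_concaveMajorant (hW : IsQuasiconcave W C) :
    ConcaveOn ℝ (Ici 0) (concaveMajorant W) := by
  refine ⟨convex_Ici 0, fun s hs t ht p q hp hq hpq => ?_⟩
  refine hW.le_concaveMajorant_of fun a b ha hb h => ?_
  have h1 := mul_le_mul_of_nonneg_left (concaveMajorant_le hs ha hb h) hp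
  have h2 := mul_le_mul_of_nonneg_left (concaveMajorant_le ht ha hb h) hq
  simp only [smul_eq_mul]
  calc _ ≤ p * (a + b * s) + q * (a + b * t) := add_le_add h1 h2
    _ = (p + q) * a + b * (p * s + q * t) := by ring
    _ = _ := by rw [hpq, one_mul]

theorem concaveMajorant_zero (hW : IsQuasiconcave W C) (h0 : Tendsto W (𝓝[>] 0) (𝓝 0)) :
    concaveMajorant W 0 = 0 := by
  refine le_antisymm ?_ (hW.concaveMajorant_nonneg le_rfl)
  have h1 : Tendsto (fun t => (1 + C) * W t) (𝓝[>] 0) (𝓝 ((1 + C) * 0)) := h0.const_mul _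
  rw [mul_zero] at h1
  refine ge_of_tendsto h1 ?_
  filter_upwards [self_mem_nhdsWithin] with t ht
  exact (hW.monotoneOn_concaveMajorant self_mem_Ici (mem_Ici_of_Ioi ht) (le_of_lt ht)).trans
    (hW.concaveMajorant_le_mul ht)

/-- Concavity gives continuity only in the interior; at `0` the majorant is squeezed between `0` and
`(1 + C) W`. -/
theorem continuousOn_concaveMajorant (hW : IsQuasiconcave W C)
    (h0 : Tendsto W (𝓝[>] 0) (𝓝 0)) : ContinuousOn (concaveMajorant W) (Ici 0) := by
  intro t ht
  rcases eq_or_lt_of_le (show (0 : ℝ) ≤ t from ht) with rfl | ht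
  · have h1 : Tendsto (fun t => (1 + C) * W t) (𝓝[>] 0) (𝓝 ((1 + C) * 0)) := h0.const_mul _
    rw [mul_zero] at h1
    rw [← continuousWithinAt_Ioi_iff_Ici, ContinuousWithinAt, hW.concaveMajorant_zero h0]
    refine tendsto_of_tendsto_of_tendsto_of_le_of_le' tendsto_const_nhds h1 ?_ ?_
    · filter_upwards [self_mem_nhdsWithin] with t ht
      exact hW.concaveMajorant_nonneg (le_of_lt ht)
    · filter_upwards [self_mem_nhdsWithin] with t ht
      exact hW.concaveMajorant_le_mul ht
  · have h := hW.concaveOn_concaveMajorant.continuousOn_interior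
    rw [interior_Ici] at h
    exact (h.continuousAt (Ioi_mem_nhds ht)).continuousWithinAt

/-- The right derivative of the least concave majorant. -/
def _root_.majorantDeriv (W : ℝ → ℝ) (t : ℝ) : ℝ := derivWithin (concaveMajorant W) (Ioi t) t

theorem hasDerivWithinAt_majorantDeriv (hW : IsQuasiconcave W C) {t : ℝ} (ht : 0 < t) :
    HasDerivWithinAt (concaveMajorant W) (majorantDeriv W t) (Ioi t) t := by
  have h := hW.concaveOn_concaveMajorant.neg.differentiableWithinAt_Ioi_of_mem_interior
    (x := t) (by rwa [interior_Ici])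
  have h' := h.neg
  rw [neg_neg] at h'
  exact h'.hasDerivWithinAt

theorem majorantDeriv_nonneg (hW : IsQuasiconcave W C) {t : ℝ} (ht : 0 < t) :
    0 ≤ majorantDeriv W t := by
  refine ge_of_tendsto (hasDerivWithinAt_iff_tendsto_slope' self_notMem_Ioi |>.1
    (hW.hasDerivWithinAt_majorantDeriv ht)) ?_
  filter_upwards [self_mem_nhdsWithin] with s hs
  rw [slope_def_field]
  exact div_nonneg (sub_nonneg.2 (hW.monotoneOn_concaveMajorant ht.le
    (ht.le.trans (le_of_lt hs)) (le_of_lt hs))) (sub_nonneg.2 (le_of_lt hs))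

theorem antitoneOn_majorantDeriv (hW : IsQuasiconcave W C) :
    AntitoneOn (majorantDeriv W) (Ioi 0) := by
  intro s hs t ht hst
  have h := hW.concaveOn_concaveMajorant.neg.monotoneOn_rightDeriv
    (by rwa [interior_Ici]) (by rwa [interior_Ici]) hst
  simp only [derivWithin.neg] at h
  exact neg_le_neg_iff.1 h

theorem integrableOn_majorantDeriv (hW : IsQuasiconcave W C) (h0 : Tendsto W (𝓝[>] 0) (𝓝 0))
    (b : ℝ) : IntegrableOn (majorantDeriv W) (Ioc 0 b) :=
  intervalIntegral.integrableOn_deriv_right_of_nonneg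
    ((hW.continuousOn_concaveMajorant h0).mono Icc_subset_Ici_self)
    (fun _ hx => hW.hasDerivWithinAt_majorantDeriv hx.1) fun _ hx => hW.majorantDeriv_nonneg hx.1

/-- A concave function has a right derivative at every interior point, which suffices for the
fundamental theorem of calculus; the majorant vanishes at `0`, so no constant appears. -/
theorem weightPrimitive_majorantDeriv (hW : IsQuasiconcave W C)
    (h0 : Tendsto W (𝓝[>] 0) (𝓝 0)) {t : ℝ} (ht : 0 ≤ t) :
    weightPrimitive (majorantDeriv W) t = concaveMajorant W t := by
  rw [weightPrimitive, intervalIntegral.integral_eq_sub_of_hasDeriv_right_of_le ht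
    ((hW.continuousOn_concaveMajorant h0).mono Icc_subset_Ici_self)
    (fun _ hx => hW.hasDerivWithinAt_majorantDeriv hx.1)
    ((intervalIntegrable_iff_integrableOn_Ioc_of_le ht).2 (hW.integrableOn_majorantDeriv h0 t)),
    hW.concaveMajorant_zero h0, sub_zero]

theorem isWeight_majorantDeriv (hW : IsQuasiconcave W C) (h0 : Tendsto W (𝓝[>] 0) (𝓝 0)) :
    IsWeight (majorantDeriv W) where
  nonneg _ ht := hW.majorantDeriv_nonneg ht
  aemeasurable := aemeasurable_restrict_of_antitoneOn measurableSet_Ioi hW.antitoneOn_majorantDeriv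
  locallyIntegrable := by
    intro x hx
    refine ⟨Icc 0 (x + 1), ?_, ?_⟩
    · rw [← Ici_inter_Iic]
      exact inter_mem_nhdsWithin _ (Iic_mem_nhds (lt_add_one x))
    · exact (integrableOn_Icc_iff_integrableOn_Ioc).2 (hW.integrableOn_majorantDeriv h0 _)

end IsQuasiconcave

variable {w : ℝ → ℝ}

theorem IsWeight.tendsto_weightPrimitive (hw : IsWeight w) :
    Tendsto (weightPrimitive w) (𝓝[>] 0) (𝓝 0) := by
  have h := intervalIntegral.continuousOn_primitive_interval (f := w) (a := 0) (b := 1)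
    (μ := volume) (hw.locallyIntegrable.integrableOn_compact_subset
      (by rw [uIcc_of_le zero_le_one]; exact Icc_subset_Ici_self) isCompact_uIcc)
  rw [uIcc_of_le zero_le_one] at h
  have h1 := (h 0 (left_mem_Icc.2 zero_le_one)).tendsto
  rw [intervalIntegral.integral_same] at h1
  refine (h1.mono_left ?_)
  rw [nhdsWithin_Icc_eq_nhdsGE one_pos]
  exact nhdsWithin_mono _ Ioi_subset_Ici_self

/-- A weight of class `R_1` has a primitive equivalent to that of a decreasing weight. -/
theorem IsRClass.exists_antitoneOn_weight (hw : IsWeight w) (h : IsRClass 1 w) :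
    ∃ v : ℝ → ℝ, IsWeight v ∧ AntitoneOn v (Ioi 0) ∧ ∃ C : ℝ, 0 < C ∧ ∀ t, 0 < t →
      weightPrimitive w t ≤ weightPrimitive v t ∧
      weightPrimitive v t ≤ C * weightPrimitive w t := by
  obtain ⟨C, hC, hCw⟩ := h
  simp only [Real.rpow_one] at hCw
  have hW : IsQuasiconcave (weightPrimitive w) C :=
    ⟨fun _ => hw.weightPrimitive_nonneg, fun _ _ => hw.weightPrimitive_mono, hC.le, hCw⟩
  have h0 := hw.tendsto_weightPrimitive
  refine ⟨_, hW.isWeight_majorantDeriv h0, hW.antitoneOn_majorantDeriv, 1 + C, by positivity,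
    fun t ht => ?_⟩
  rw [hW.weightPrimitive_majorantDeriv h0 ht.le]
  exact ⟨hW.le_concaveMajorant ht.le, hW.concaveMajorant_le_mul ht⟩

/-- A zero of `W` would spread to the left by monotonicity and to the right by `R_1`, forcing `w =
0` almost everywhere. -/
theorem IsRClass.weightPrimitive_pos (hw : IsWeight w)
    (hw_ne : ¬ w =ᵐ[volume.restrict (Ioi (0 : ℝ))] 0) (h : IsRClass 1 w) {t : ℝ} (ht : 0 < t) :
    0 < weightPrimitive w t := by
  refine (hw.weightPrimitive_nonneg ht.le).lt_of_ne' fun h0 => hw_ne ?_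
  obtain ⟨C, -, hCw⟩ := h
  have hz : ∀ s, weightMeasure w (Iic s) = 0 := by
    intro s
    rcases le_or_gt s 0 with hs | hs
    · exact weightMeasure_Iic_of_nonpos hs
    rw [weightMeasure_Iic hw hs.le, ENNReal.ofReal_eq_zero]
    rcases le_or_gt s t with hst | hst
    · exact (hw.weightPrimitive_mono hs.le hst).trans h0.le
    · have := hCw t s ht hst
      simp only [Real.rpow_one, h0, zero_div, mul_zero] at this
      rwa [div_le_iff₀ hs, zero_mul] at this
  have hzero : weightMeasure w = 0 := by
    rw [← Measure.measure_univ_eq_zero, ← le_zero_iff]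
    exact IsLowerSet.measure_le_of_forall_Iic (ν₂ := 0) (fun s => (hz s).le) isLowerSet_univ
  rw [weightMeasure, withDensity_eq_zero_iff hw.aemeasurable.ennreal_ofReal] at hzero
  filter_upwards [hzero, ae_restrict_mem measurableSet_Ioi] with s h1 h2
  exact le_antisymm (ENNReal.ofReal_eq_zero.1 h1) (hw.nonneg s h2)

end ConcaveMajorant

/-! ### Sufficiency: subadditivity for decreasing weights and equivalence of the functionals. -/

section Sufficiency

variable {X : Type*} [MeasurableSpace X] {μ : Measure X} {v w : ℝ → ℝ}

theorem lorentz_le_mul_of_weightPrimitive_le (hw : IsWeight w) (hv : IsWeight v) {C : ℝ}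
    (hC : 0 ≤ C) (h : ∀ t, 0 < t → weightPrimitive w t ≤ C * weightPrimitive v t)
    (F : X → ℝ≥0∞) :
    lorentz μ (weightMeasure w) F ≤ ENNReal.ofReal C * lorentz μ (weightMeasure v) F := by
  have h1 : ENNReal.ofReal C * lorentz μ (weightMeasure v) F =
      ∫⁻ t, rearr μ F t ∂(ENNReal.ofReal C • weightMeasure v) := by
    rw [lintegral_smul_measure, smul_eq_mul, lorentz]
  rw [h1]
  refine Antitone.lintegral_le_of_forall_Iic (fun t => ?_) (rearr_antitone F)
  rcases le_or_gt t 0 with ht | ht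
  · rw [weightMeasure_Iic_of_nonpos ht]
    exact bot_le
  · rw [Measure.smul_apply, smul_eq_mul, weightMeasure_Iic hw ht.le, weightMeasure_Iic hv ht.le,
      ← ENNReal.ofReal_mul hC]
    exact ENNReal.ofReal_le_ofReal (h t ht)

/-- Hardy's lemma with the roles exchanged: `v` is the decreasing integrand, and the measures are
`F^* dt` and `(G^* + H^*) dt`, compared on half-lines by subadditivity of `∫₀ᵗ F^*`. -/
theorem lorentz_le_add [SFinite μ] (hv : IsWeight v) (hanti : AntitoneOn v (Ioi 0))
    {F G H : X → ℝ≥0∞} (hF : Measurable F) (hG : Measurable G) (hH : Measurable H)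
    (h : ∀ᵐ x ∂μ, F x ≤ G x + H x) :
    lorentz μ (weightMeasure v) F ≤
      lorentz μ (weightMeasure v) G + lorentz μ (weightMeasure v) H := by
  -- The value `⊤` off `(0, ∞)` makes `g` antitone on the whole line; the measures do not see that
  -- region.
  let g : ℝ → ℝ≥0∞ := fun t => if 0 < t then ENNReal.ofReal (v t) else ⊤
  have hg : Antitone g := by
    intro s t hst
    simp only [g]
    by_cases hs : 0 < s
    · rw [if_pos hs, if_pos (hs.trans_le hst)]
      exact ENNReal.ofReal_le_ofReal (hanti hs (hs.trans_le hst) hst)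
    · rw [if_neg hs]
      exact le_top
  have key : ∀ R : ℝ → ℝ≥0∞, Measurable R → ∫⁻ t, R t ∂weightMeasure v =
      ∫⁻ t, g t ∂(volume.restrict (Ioi (0 : ℝ))).withDensity R := by
    intro R hR
    rw [lintegral_weightMeasure hv.aemeasurable hR, lintegral_withDensity_eq_lintegral_mul₀
      hR.aemeasurable hg.measurable.aemeasurable]
    refine setLIntegral_congr_fun measurableSet_Ioi fun t ht => ?_
    simp only [g, Pi.mul_apply, if_pos (show 0 < t from ht)]
  have hIic : ∀ (R : ℝ → ℝ≥0∞) (t : ℝ),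
      (volume.restrict (Ioi (0 : ℝ))).withDensity R (Iic t) = ∫⁻ s in Ioc (0 : ℝ) t, R s := by
    intro R t
    rw [withDensity_apply _ measurableSet_Iic, Measure.restrict_restrict measurableSet_Iic,
      inter_comm, Ioi_inter_Iic]
  rw [lorentz, lorentz, lorentz, ← lintegral_add_left (measurable_rearr G),
    key _ (measurable_rearr F), key (fun t => rearr μ G t + rearr μ H t)
      ((measurable_rearr G).add (measurable_rearr H))]
  refine hg.lintegral_le_of_forall_Iic fun t => ?_
  rw [hIic, hIic]
  refine (lintegral_Ioc_rearr_subadd hF hG hH h t).trans (le_of_eq ?_)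
  rw [← lintegral_add_left (measurable_rearr G)]

theorem lorentz_zero (ν : Measure ℝ) : lorentz μ ν (fun _ => 0) = 0 := by
  simpa using lorentz_const_mul (μ := μ) (ν := ν) ENNReal.zero_ne_top (fun _ => 0)

theorem lorentz_tsum_le [SFinite μ] (hv : IsWeight v) (hanti : AntitoneOn v (Ioi 0))
    {D : ℕ → X → ℝ≥0∞} (hD : ∀ k, Measurable (D k)) :
    lorentz μ (weightMeasure v) (fun x => ∑' k, D k x) ≤
      ∑' k, lorentz μ (weightMeasure v) (D k) := by
  have hfin : ∀ N, lorentz μ (weightMeasure v) (fun x => ∑ k ∈ Finset.range N, D k x) ≤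
      ∑ k ∈ Finset.range N, lorentz μ (weightMeasure v) (D k) := by
    intro N
    induction N with
    | zero => simp [lorentz_zero]
    | succ N ih =>
      rw [Finset.sum_range_succ]
      refine (lorentz_le_add hv hanti (Finset.measurable_fun_sum _ fun k _ => hD k)
        (Finset.measurable_fun_sum (Finset.range N) fun k _ => hD k) (hD N)
        (ae_of_all _ fun x => (Finset.sum_range_succ _ _).le)).trans ?_
      gcongr
  simp only [ENNReal.tsum_eq_iSup_nat]
  rw [lorentz_iSup (F := fun N x => ∑ k ∈ Finset.range N, D k x) fun M N hMN x =>
    Finset.sum_le_sum_of_subset (Finset.range_mono hMN)]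
  exact iSup_mono hfin

theorem ENNReal.eq_zero_of_forall_le_ofReal {m : ℝ≥0∞}
    (h : ∀ t : ℝ, 0 < t → m ≤ ENNReal.ofReal t) : m = 0 := by
  by_contra hm
  obtain ⟨t, -, h1, h2⟩ := ENNReal.lt_iff_exists_real_btwn.1 (pos_iff_ne_zero.2 hm)
  exact absurd (h t (ENNReal.ofReal_pos.1 h1)) (not_le.2 h2)

theorem rearr_mul_weightPrimitive_le (hw : IsWeight w) (F : X → ℝ≥0∞) {t : ℝ} (ht : 0 ≤ t) :
    rearr μ F t * ENNReal.ofReal (weightPrimitive w t) ≤ lorentz μ (weightMeasure w) F := by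
  rw [← weightMeasure_Iic hw ht, ← setLIntegral_const]
  exact (setLIntegral_mono (measurable_rearr F) fun s hs => rearr_antitone F hs).trans
    (setLIntegral_le_lintegral _ _)

/-- By the Chebyshev-type bound `F^*(t) W(t) ≤ Λ(F)`, `F^*(t)` is finite for every `t > 0`, so `{F =
∞}` has measure at most every such `t`. -/
theorem ae_lt_top_of_lorentz_lt_top (hw : IsWeight w) (hpos : ∀ t, 0 < t → 0 < weightPrimitive w t)
    {F : X → ℝ≥0∞} (hF : lorentz μ (weightMeasure w) F < ∞) : ∀ᵐ x ∂μ, F x < ∞ := by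
  rw [ae_iff]
  refine ENNReal.eq_zero_of_forall_le_ofReal fun t ht => ?_
  have h1 : rearr μ F t < ∞ := by
    by_contra hc
    rw [not_lt, top_le_iff] at hc
    have h2 := rearr_mul_weightPrimitive_le (μ := μ) hw F ht.le
    rw [hc, ENNReal.top_mul (by simpa using hpos t ht)] at h2
    exact absurd hF (not_lt.2 h2)
  refine (measure_mono fun x hx => ?_).trans ((rearr_le_iff F t _).1 le_rfl)
  exact lt_of_lt_of_le h1 (not_lt.1 hx)

theorem ae_eq_zero_of_lorentz_eq_zero (hw : IsWeight w)
    (hpos : ∀ t, 0 < t → 0 < weightPrimitive w t)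
    {F : X → ℝ≥0∞} (hF : lorentz μ (weightMeasure w) F = 0) : F =ᵐ[μ] fun _ => 0 := by
  rw [EventuallyEq, ae_iff]
  refine ENNReal.eq_zero_of_forall_le_ofReal fun t ht => ?_
  have h1 : rearr μ F t = 0 := by
    have h2 := rearr_mul_weightPrimitive_le (μ := μ) hw F ht.le
    rw [hF, le_zero_iff, mul_eq_zero] at h2
    exact h2.resolve_right (by simpa using hpos t ht)
  refine (measure_mono fun x hx => ?_).trans ((rearr_le_iff F t _).1 le_rfl)
  rw [h1]
  exact pos_iff_ne_zero.2 hx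

variable {n : ℕ} {α : ℝ}

/-- If `Γ_α^1(w)` and `Λ^1(w)` coincide as sets, their functionals are equivalent. -/
theorem exists_mixedLorentz_le_of_eq (hw : IsWeight w) (hv : IsWeight v)
    (hanti : AntitoneOn v (Ioi 0)) (hα : 0 < α) (hα' : α < 1)
    (hpos : ∀ t, 0 < t → 0 < weightPrimitive w t) {C : ℝ} (hC : 0 ≤ C)
    (hwv : ∀ t, 0 < t → weightPrimitive w t ≤ weightPrimitive v t)
    (hvw : ∀ t, 0 < t → weightPrimitive v t ≤ C * weightPrimitive w t)
    (heq : gammaSpace n 1 α w = lambdaSpace n 1 w) :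
    ∃ K : ℝ, 0 < K ∧ ∀ f : LebesgueFun n, gammaNorm 1 α w f ≤
      ENNReal.ofReal K * lambdaNorm 1 w f := by
  by_contra! hcon
  simp only [gammaNorm_one_eq hw, lambdaNorm_one_eq hw] at hcon
  -- The ratio `4 ^ k` leaves room to normalise to `Λ(D k) = 2 ^ (-k)`, which is summable, while
  -- `Γ(D k) ≥ 2 ^ k` is unbounded.
  choose f hf using fun k : ℕ => hcon (4 ^ k) (by positivity)
  set μ : Measure (EuclideanSpace ℝ (Fin n)) := volume
  set L : ℕ → ℝ≥0∞ := fun k => lorentz μ (weightMeasure w) fun x => ‖f k x‖ₑ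
  have hL0 : ∀ k, L k ≠ 0 := by
    intro k h0
    have h1 := ae_eq_zero_of_lorentz_eq_zero hw hpos h0
    have h2 := hf k
    rw [mixedLorentz_congr h1] at h2
    have h3 : mixedLorentz μ (weightMeasure w) α (fun _ => 0) = 0 := by
      simpa using mixedLorentz_const_mul (μ := μ) (ν := weightMeasure w) hα.le hα'.le
        ENNReal.zero_ne_top (fun _ => 0)
    rw [h3] at h2
    exact absurd h2 not_lt_bot
  have hLtop : ∀ k, L k ≠ ∞ := by
    intro k h0
    have h2 := hf k
    change _ * L k < _ at h2
    rw [h0, ENNReal.mul_top (by simp)] at h2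
    exact absurd h2 not_top_lt
  set c : ℕ → ℝ≥0∞ := fun k => (2 ^ k * L k)⁻¹
  have hc : ∀ k, c k ≠ ∞ := fun k =>
    ENNReal.inv_ne_top.2 (mul_ne_zero (by simp) (hL0 k))
  have hcL : ∀ k, c k * L k = 2⁻¹ ^ k := by
    intro k
    simp only [c]
    rw [ENNReal.mul_inv (Or.inl (by simp)) (Or.inl (by simp)), mul_assoc,
      ENNReal.inv_mul_cancel (hL0 k) (hLtop k), mul_one, ENNReal.inv_pow]
  set D : ℕ → EuclideanSpace ℝ (Fin n) → ℝ≥0∞ := fun k x => c k * ‖f k x‖ₑ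
  have hD : ∀ k, Measurable (D k) := fun k => (f k).measurable_enorm.const_mul _
  have hDL : ∀ k, lorentz μ (weightMeasure w) (D k) = 2⁻¹ ^ k := fun k => by
    rw [← hcL k]
    exact lorentz_const_mul (hc k) _
  have hDG : ∀ k, (2 : ℝ≥0∞) ^ k ≤ mixedLorentz μ (weightMeasure w) α (D k) := by
    intro k
    simp only [D]
    rw [mixedLorentz_const_mul hα.le hα'.le (hc k)]
    calc (2 : ℝ≥0∞) ^ k = 4 ^ k * 2⁻¹ ^ k := by
          rw [show (4 : ℝ≥0∞) = 2 * 2 by norm_num, mul_pow, mul_assoc, ← mul_pow,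
            ENNReal.mul_inv_cancel (by simp) (by simp), one_pow, mul_one]
      _ = c k * (ENNReal.ofReal (4 ^ k) * L k) := by
          rw [← hcL k, ENNReal.ofReal_pow (by norm_num)]
          simp only [ENNReal.ofReal_ofNat]
          ring
      _ ≤ _ := by
          gcongr
          exact (hf k).le
  set F : EuclideanSpace ℝ (Fin n) → ℝ≥0∞ := fun x => ∑' k, D k x
  have hF : Measurable F := Measurable.tsum hD
  -- Countable subadditivity is available only for `v`, so the estimate passes from `w` to `v` and
  -- back.
  have hFL : lorentz μ (weightMeasure w) F < ∞ := by
    have h1 : lorentz μ (weightMeasure w) F ≤ ENNReal.ofReal 1 * lorentz μ (weightMeasure v) F :=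
      lorentz_le_mul_of_weightPrimitive_le hw hv zero_le_one
        (fun t ht => by simpa using hwv t ht) F
    have h2 := lorentz_tsum_le (μ := μ) hv hanti hD
    have h3 : ∑' k, lorentz μ (weightMeasure v) (D k) ≤ ENNReal.ofReal C * ∑' k : ℕ, 2⁻¹ ^ k := by
      rw [← ENNReal.tsum_mul_left]
      refine ENNReal.tsum_le_tsum fun k => ?_
      rw [← hDL k]
      exact lorentz_le_mul_of_weightPrimitive_le hv hw hC hvw _
    rw [ENNReal.ofReal_one, one_mul] at h1
    refine (h1.trans (h2.trans h3)).trans_lt (ENNReal.mul_lt_top ENNReal.ofReal_lt_top ?_)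
    rw [ENNReal.tsum_geometric, ENNReal.one_sub_inv_two, inv_inv]
    simp
  have hFfin := ae_lt_top_of_lorentz_lt_top hw hpos hFL
  have hgm : AEStronglyMeasurable (fun x => (F x).toReal) μ :=
    hF.ennreal_toReal.aestronglyMeasurable
  have hgF : (fun x => ‖(AEEqFun.mk _ hgm : LebesgueFun n) x‖ₑ) =ᵐ[μ] F := by
    filter_upwards [AEEqFun.coeFn_mk _ hgm, hFfin] with x h1 h2
    rw [h1, Real.enorm_eq_ofReal ENNReal.toReal_nonneg, ENNReal.ofReal_toReal h2.ne]
  have hmem : (AEEqFun.mk _ hgm : LebesgueFun n) ∈ gammaSpace n 1 α w := by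
    rw [heq]
    simp only [lambdaSpace, mem_ofPred_eq, lambdaNorm_one_eq hw]
    rwa [lorentz_congr hgF]
  simp only [gammaSpace, mem_ofPred_eq, gammaNorm_one_eq hw] at hmem
  rw [mixedLorentz_congr hgF] at hmem
  obtain ⟨N, hN⟩ := ENNReal.exists_nat_gt hmem.ne
  have h1 : (N : ℝ≥0∞) ≤ 2 ^ N := by exact_mod_cast Nat.lt_two_pow_self.le
  have h2 : mixedLorentz μ (weightMeasure w) α (D N) ≤ mixedLorentz μ (weightMeasure w) α F :=
    mixedLorentz_mono hα.le hα'.le (ae_of_all _ fun x => ENNReal.le_tsum N)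
  exact absurd hN (not_lt.2 (h1.trans ((hDG N).trans h2)))

/-! ### Sufficiency: the norm given by a decreasing weight, and its completeness. -/

/-- The functional `∫ f^* dν` on classes of functions. -/
def lorentzNorm (v : ℝ → ℝ) (f : LebesgueFun n) : ℝ≥0∞ :=
  lorentz volume (weightMeasure v) fun x => ‖f x‖ₑ

theorem lorentzNorm_add_le (hv : IsWeight v) (hanti : AntitoneOn v (Ioi 0)) (f g : LebesgueFun n) :
    lorentzNorm v (f + g) ≤ lorentzNorm v f + lorentzNorm v g := by
  refine lorentz_le_add hv hanti (f + g).measurable_enorm f.measurable_enorm g.measurable_enorm ?_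
  filter_upwards [AEEqFun.coeFn_add f g] with x hx
  rw [hx]
  exact enorm_add_le _ _

theorem lorentzNorm_smul (c : ℝ) (f : LebesgueFun n) :
    lorentzNorm v (c • f) = ‖c‖ₑ * lorentzNorm v f := by
  rw [lorentzNorm, lorentzNorm, ← lorentz_const_mul enorm_ne_top]
  refine lorentz_congr ?_
  filter_upwards [AEEqFun.coeFn_smul c f] with x hx
  rw [hx, Pi.smul_apply, enorm_smul]

/-- Riesz–Fischer: a series of increments with summable norms converges. -/
theorem exists_lorentzNorm_sub_le (hv : IsWeight v) (hanti : AntitoneOn v (Ioi 0))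
    (hpos : ∀ t, 0 < t → 0 < weightPrimitive v t) (a : ℕ → LebesgueFun n)
    (ha : ∑' k, lorentzNorm v (a (k + 1) - a k) ≠ ∞) :
    ∃ g : LebesgueFun n, ∀ k,
      lorentzNorm v (a k - g) ≤ ∑' m, lorentzNorm v (a (m + k + 1) - a (m + k)) := by
  set D : ℕ → EuclideanSpace ℝ (Fin n) → ℝ≥0∞ := fun k x => ‖(a (k + 1) - a k) x‖ₑ
  have hD : ∀ k, Measurable (D k) := fun k => (a (k + 1) - a k).measurable_enorm
  have hfin : ∀ᵐ x, ∑' k, D k x < ∞ := ae_lt_top_of_lorentz_lt_top hv hpos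
    ((lorentz_tsum_le hv hanti hD).trans_lt (lt_top_iff_ne_top.2 ha))
  have hedist : ∀ᵐ x, ∀ k, edist (a k x) (a (k + 1) x) ≤ D k x := by
    rw [ae_all_iff]
    intro k
    filter_upwards [AEEqFun.coeFn_sub (a (k + 1)) (a k)] with x hx
    simp only [D]
    rw [hx, edist_comm, edist_eq_enorm_sub, Pi.sub_apply]
  obtain ⟨g, hg, hlim⟩ := exists_stronglyMeasurable_limit_of_tendsto_ae
    (fun k => (a k).aestronglyMeasurable) (by
      filter_upwards [hfin, hedist] with x h1 h2
      exact cauchySeq_tendsto_of_complete (cauchySeq_of_edist_le_of_tsum_ne_top _ h2 h1.ne))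
  refine ⟨AEEqFun.mk g hg.aestronglyMeasurable, fun k => ?_⟩
  refine le_trans (lorentz_mono ?_) (lorentz_tsum_le hv hanti fun m => hD (m + k))
  filter_upwards [hedist, hlim, AEEqFun.coeFn_mk g hg.aestronglyMeasurable,
    AEEqFun.coeFn_sub (a k) (AEEqFun.mk g hg.aestronglyMeasurable)] with x h1 h2 h3 h4
  rw [h4, Pi.sub_apply, h3, ← edist_eq_enorm_sub]
  refine (edist_le_tsum_of_edist_le_of_tendsto _ h1 h2 k).trans (le_of_eq ?_)
  exact tsum_congr fun m => by rw [add_comm k m]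

theorem isBanachSpaceFor_of_equivalent {ρ : LebesgueFun n → ℝ≥0∞} (hv : IsWeight v)
    (hanti : AntitoneOn v (Ioi 0)) (hpos : ∀ t, 0 < t → 0 < weightPrimitive v t) {C : ℝ}
    (hC : 0 < C) (h1 : ∀ f, lorentzNorm v f ≤ ENNReal.ofReal C * ρ f)
    (h2 : ∀ f, ρ f ≤ ENNReal.ofReal C * lorentzNorm v f) : IsBanachSpaceFor ρ := by
  have hiff : ∀ f, ρ f < ∞ ↔ lorentzNorm v f < ∞ := fun f =>
    ⟨fun h => (h1 f).trans_lt (ENNReal.mul_lt_top ENNReal.ofReal_lt_top h),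
      fun h => (h2 f).trans_lt (ENNReal.mul_lt_top ENNReal.ofReal_lt_top h)⟩
  let V : Submodule ℝ (LebesgueFun n) :=
    { carrier := {f | lorentzNorm v f < ∞}
      zero_mem' := by
        have := lorentzNorm_smul (v := v) 0 (0 : LebesgueFun n)
        rw [zero_smul, enorm_zero, zero_mul] at this
        simp [this]
      add_mem' := fun {f g} hf hg =>
        (lorentzNorm_add_le hv hanti f g).trans_lt (ENNReal.add_lt_top.2 ⟨hf, hg⟩)
      smul_mem' := fun c f hf => by
        simp only [mem_ofPred_eq] at hf ⊢
        rw [lorentzNorm_smul]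
        exact ENNReal.mul_lt_top enorm_lt_top hf }
  have hV : ∀ f : V, lorentzNorm v (f : LebesgueFun n) ≠ ∞ := fun f => ne_of_lt f.2
  let N : Seminorm ℝ V := Seminorm.of (fun f => (lorentzNorm v (f : LebesgueFun n)).toReal)
    (fun f g => by
      rw [← ENNReal.toReal_add (hV f) (hV g)]
      exact ENNReal.toReal_mono (ENNReal.add_ne_top.2 ⟨hV f, hV g⟩)
        (lorentzNorm_add_le hv hanti _ _))
    (fun c f => by
      rw [Submodule.coe_smul, lorentzNorm_smul, ENNReal.toReal_mul, toReal_enorm])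
  have hN : ∀ f : V, ENNReal.ofReal (N f) = lorentzNorm v (f : LebesgueFun n) := fun f =>
    ENNReal.ofReal_toReal (hV f)
  refine ⟨V, ?_, N, ?_, ⟨C, hC, fun f => ?_⟩, ?_⟩
  · ext f
    exact (hiff f).symm
  · intro f hf
    have h0 : lorentzNorm v (f : LebesgueFun n) = 0 := by rw [← hN, hf, ENNReal.ofReal_zero]
    refine Subtype.ext (AEEqFun.ext ?_)
    filter_upwards [ae_eq_zero_of_lorentz_eq_zero hv hpos h0,
      AEEqFun.coeFn_zero (α := EuclideanSpace ℝ (Fin n)) (μ := volume) (β := ℝ)] with x hx hx0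
    rw [Submodule.coe_zero, hx0, enorm_eq_zero.1 hx, Pi.zero_apply]
  · rw [hN]
    exact ⟨h1 f, h2 f⟩
  · intro u hu
    choose K hK using fun k : ℕ => hu ((1 / 2) ^ k) (by positivity)
    -- The supremum makes `φ` monotone and above `K`, so increments along it are summable; the
    -- summand `k` makes it tend to infinity.
    let φ : ℕ → ℕ := fun k => (Finset.range (k + 1)).sup K + k
    have hφ : Monotone φ := fun i j hij =>
      add_le_add (Finset.sup_mono (Finset.range_mono (Nat.succ_le_succ hij))) hij
    have hKφ : ∀ k, K k ≤ φ k := fun k =>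
      (Finset.le_sup (Finset.self_mem_range_succ k)).trans (Nat.le_add_right _ _)
    have hstep : ∀ k, lorentzNorm v ((u (φ (k + 1)) : LebesgueFun n) - (u (φ k) : LebesgueFun n)) ≤
        2⁻¹ ^ k := by
      intro k
      have h3 := (hK k _ _ ((hKφ k).trans (hφ k.le_succ)) (hKφ k)).le
      have h4 := ENNReal.ofReal_le_ofReal h3
      rw [hN, ENNReal.ofReal_pow (by norm_num), one_div, ENNReal.ofReal_inv_of_pos two_pos,
        ENNReal.ofReal_ofNat] at h4
      exact h4
    have hsum : ∑' k, lorentzNorm v ((u (φ (k + 1)) : LebesgueFun n) - (u (φ k) : LebesgueFun n)) ≠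
        ∞ := by
      refine ne_top_of_le_ne_top ?_ (ENNReal.tsum_le_tsum hstep)
      rw [ENNReal.tsum_geometric, ENNReal.one_sub_inv_two, inv_inv]
      simp
    obtain ⟨g, hg⟩ := exists_lorentzNorm_sub_le hv hanti hpos
      (fun k => (u (φ k) : LebesgueFun n)) hsum
    have htail : Tendsto (fun k => lorentzNorm v ((u (φ k) : LebesgueFun n) - g)) atTop (𝓝 0) :=
      tendsto_of_tendsto_of_tendsto_of_le_of_le tendsto_const_nhds
        (ENNReal.tendsto_sum_nat_add _ hsum) (fun _ => bot_le) hg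
    -- One difference of finite norm places the limit in `V`; a Cauchy sequence with a convergent
    -- subsequence then converges.
    obtain ⟨k₀, hk₀⟩ := (htail.eventually (gt_mem_nhds one_pos)).exists
    have hdV : (u (φ k₀) : LebesgueFun n) - g ∈ V := hk₀.trans ENNReal.one_lt_top
    have hgV : g ∈ V := by
      have : (u (φ k₀) : LebesgueFun n) - ((u (φ k₀) : LebesgueFun n) - g) ∈ V :=
        V.sub_mem (u (φ k₀)).2 hdV
      rwa [sub_sub_cancel] at this
    refine ⟨⟨g, hgV⟩, ?_⟩
    have htail' : Tendsto (fun k => N (u (φ k) - ⟨g, hgV⟩)) atTop (𝓝 0) :=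
      (ENNReal.tendsto_toReal ENNReal.zero_ne_top).comp htail
    rw [Metric.tendsto_atTop]
    intro ε hε
    obtain ⟨M, hM⟩ := hu (ε / 2) (half_pos hε)
    obtain ⟨j, hj, hjM⟩ := ((htail'.eventually (gt_mem_nhds (half_pos hε))).and
      (eventually_ge_atTop M)).exists
    refine ⟨M, fun k hk => ?_⟩
    rw [Real.dist_0_eq_abs, abs_of_nonneg (apply_nonneg N _)]
    have h3 := hM k (φ j) hk (hjM.trans (Nat.le_add_left _ _))
    have h4 := map_add_le_add N (u k - u (φ j)) (u (φ j) - ⟨g, hgV⟩)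
    rw [sub_add_sub_cancel] at h4
    linarith

theorem isBanachSpaceFor_gammaNorm (hw : IsWeight w)
    (hw_ne : ¬ w =ᵐ[volume.restrict (Ioi (0 : ℝ))] 0) (hα : 0 < α) (hα' : α < 1)
    (h : IsRClass 1 w) (heq : gammaSpace n 1 α w = lambdaSpace n 1 w) :
    IsBanachSpaceFor (gammaNorm (n := n) 1 α w) := by
  obtain ⟨v, hv, hanti, C, hC, hvw⟩ := h.exists_antitoneOn_weight hw
  have hpos : ∀ t, 0 < t → 0 < weightPrimitive w t := fun t ht => h.weightPrimitive_pos hw hw_ne ht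
  obtain ⟨K, hK, hKf⟩ := exists_mixedLorentz_le_of_eq hw hv hanti hα hα' hpos hC.le
    (fun t ht => (hvw t ht).1) (fun t ht => (hvw t ht).2) heq
  -- `C + K` dominates both `C`, from `Λ(v) ≤ C Λ(w) ≤ C Γ`, and `K`, from `Γ ≤ K Λ(w) ≤ K Λ(v)`.
  refine isBanachSpaceFor_of_equivalent hv hanti (fun t ht => (hpos t ht).trans_le (hvw t ht).1)
    (C := C + K) (by positivity) (fun f => ?_) (fun f => ?_)
  · calc lorentzNorm v f ≤ ENNReal.ofReal C * lambdaNorm 1 w f := by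
          rw [lambdaNorm_one_eq hw]
          exact lorentz_le_mul_of_weightPrimitive_le hv hw hC.le (fun t ht => (hvw t ht).2) _
      _ ≤ ENNReal.ofReal (C + K) * gammaNorm 1 α w f := by
          rw [lambdaNorm_one_eq hw, gammaNorm_one_eq hw]
          gcongr
          · linarith
          · exact lorentz_le_mixedLorentz (weightMeasure_pos w) hα.le hα'.le _
  · calc gammaNorm 1 α w f ≤ ENNReal.ofReal K * lambdaNorm 1 w f := hKf f
      _ ≤ ENNReal.ofReal (C + K) * (ENNReal.ofReal 1 * lorentzNorm v f) := by
          rw [lambdaNorm_one_eq hw]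
          gcongr
          · linarith
          · exact lorentz_le_mul_of_weightPrimitive_le hw hv zero_le_one
              (fun t ht => by simpa using (hvw t ht).1) _
      _ = _ := by rw [ENNReal.ofReal_one, one_mul]

end Sufficiency

end

theorem mainTheorem5 (n : ℕ) (hn : 0 < n) (w : ℝ → ℝ) (hw : IsWeight w)
    (hw_ne : ¬ w =ᵐ[volume.restrict (Ioi (0 : ℝ))] 0)
    (α : ℝ) (hα_pos : 0 < α) (hα_lt : α < 1) :
    IsBanachSpaceFor (gammaNorm (n := n) 1 α w) ↔
      IsRClass 1 w ∧ gammaSpace n 1 α w = lambdaSpace n 1 w :=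
  ⟨fun h => ⟨h.isRClass hn hw hα_pos hα_lt.le, h.gammaSpace_eq hw hα_pos hα_lt⟩,
    fun h => isBanachSpaceFor_gammaNorm hw hw_ne hα_pos hα_lt h.1 h.2⟩
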